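/- Let $G = SU(2)\times SU(2)$, and let $\alpha_i, e_i^+, e_i^-$ ($i=1,2$, one triple for each factor) be the basis of left-invariant real 1-forms on $G$ satisfying the Maurer–Cartan equations $$d\alpha_i = e_i^-\wedge e_i^+,\qquad de_i^+ = \alpha_i\wedge e_i^-,\qquad de_i^- = -\alpha_i\wedge e_i^+ .$$ (Explicitly, identifying $SU(2)$ with the group of unit quaternions $q$, take $\alpha_i, e_i^-, e_i^+$ to be $-2$ times the $\mathbf i,\mathbf j,\mathbf k$-components of the left-invariant form $q^{-1}dq$ of the $i$-th factor.) Let $a,b\in\mathbb R$ with $b\neq 0$, put $c=-\frac{a^2+1}{b}$, and let $J$ be the left-invariant complex structure on $G$ determined by $$J\alpha_1 = a\alpha_1+b\alpha_2,\quad J\alpha_2 = c\,\alpha_1-a\alpha_2,\quad J e_i^+=e_i^-,\quad J e_i^-=-e_i^+ \qquad (i=1,2),$$ where $(J\xi)(X)=\xi(JX)$ for a 1-form $\xi$ and a tangent vector $X$. A Riemannian metric $g$ with $g(JX,JY)=g(X,Y)$ is called CYT (Calabi–Yau with torsion) if the Ricci form $\rho^B(X,Y)=\sum_k g(R^B(X,Y)E_k,JE_k)$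 vanishes, where $(E_k)$ is a local $g$-orthonormal frame and $R^B$ is the curvature of the Bismut connection of $(g,J)$, that is, the unique linear connection with $\nabla g=0$, $\nabla J=0$ and totally skew-symmetric torsion. Then there is a left-invariant CYT metric on $(G,J)$ if and only if $$b(b-a)>0\quad\text{and}\quad a^2+1-ab>0 .$$ -/

import Mathlib

open scoped Manifold ContDiff Quaternion Bundle

noncomputable section

namespace CYT

/-! ### Connections with skew torsion and the CYT condition on a manifold -/

section Geometry

variable {E : Type*} [NormedAddCommGroup E] [NormedSpace ℝ E] [FiniteDimensional ℝ E]
  {H : Type*} [TopologicalSpace H] (I : ModelWithCorners ℝ E H)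
  (M : Type*) [TopologicalSpace M] [ChartedSpace H M] [IsManifold I ∞ M]

/-- (Not necessarily continuous) vector fields on `M`. -/
abbrev VField : Type _ := (x : M) → TangentSpace I x

/-- Fields of endomorphisms of the tangent spaces of `M`. -/
abbrev EndField : Type _ := (x : M) → TangentSpace I x →L[ℝ] TangentSpace I x

/-- Smooth Riemannian metrics on `M`. -/
abbrev SmoothMetric : Type _ :=
  Bundle.ContMDiffRiemannianMetric I ∞ E (TangentSpace I : M → Type _)

/-- Linear connections on `M`. On differentiable fields, `D Y x (X x)` is `(∇_X Y)(x)`. -/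
abbrev Connection : Type _ := CovariantDerivative I E (TangentSpace I : M → Type _)

variable {I M}

/-- The vector field `X` is smooth. -/
def SmoothField (X : VField I M) : Prop :=
  ContMDiff I I.tangent ∞ (fun x ↦ (⟨x, X x⟩ : TangentBundle I M))

/-- The metric is Hermitian with respect to `J`: `g(JX, JY) = g(X, Y)`. -/
def IsHermitian (J : EndField I M) (g : SmoothMetric I M) : Prop :=
  ∀ (x : M) (u v : TangentSpace I x), g.inner x (J x u) (J x v) = g.inner x u v

/-- `D` is the Bismut (Kähler-with-torsion) connection of the Hermitian structure `(J, g)`: the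
unique connection with `∇g = 0`, `∇J = 0` and totally skew-symmetric torsion. Torsion is always
skew in its first two arguments, so it is enough to ask that `g(T(X, Y), Z)` be skew in `Y, Z`. -/
structure IsBismut (J : EndField I M) (g : SmoothMetric I M) (D : Connection I M) : Prop where
  metric : ∀ Y Z : VField I M, SmoothField Y → SmoothField Z →
    ∀ (x : M) (u : TangentSpace I x),
      mvfderiv I (fun y ↦ g.inner y (Y y) (Z y)) x u =
        g.inner x (D Y x u) (Z x) + g.inner x (Y x) (D Z x u)
  complex : ∀ Y : VField I M, SmoothField Y →
    ∀ (x : M) (u : TangentSpace I x), D (fun y ↦ J y (Y y)) x u = J x (D Y x u)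
  skew : ∀ (x : M) (u v w : TangentSpace I x),
    g.inner x (D.torsion x u v) w = - g.inner x (D.torsion x u w) v

/-- The curvature `R(X, Y)Z = ∇_X ∇_Y Z - ∇_Y ∇_X Z - ∇_[X, Y] Z`. -/
def curvature (D : Connection I M) (X Y Z : VField I M) : VField I M := fun x ↦
  D (fun y ↦ D Z y (Y y)) x (X x) - D (fun y ↦ D Z y (X y)) x (Y x)
    - D Z x (VectorField.mlieBracket I X Y x)

/-- The Ricci form `ρ(X, Y) = ∑ᵢ g(R(X, Y)Eᵢ, J Eᵢ)` of the connection `D` vanishes; at each point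
`x` the sum runs over smooth fields `Eᵢ` whose values at `x` form a `g`-orthonormal basis of the
tangent space. -/
def RicciFormVanishes (J : EndField I M) (g : SmoothMetric I M) (D : Connection I M) : Prop :=
  ∀ X Y : VField I M, SmoothField X → SmoothField Y → ∀ x : M,
    ∀ e : Fin (Module.finrank ℝ E) → VField I M, (∀ i, SmoothField (e i)) →
      (∀ i j, g.inner x (e i x) (e j x) = if i = j then 1 else 0) →
      ∑ i, g.inner x (curvature D X Y (e i) x) (J x (e i x)) = 0

/-- `g` is a CYT (Calabi-Yau with torsion) metric on `(M, J)`: it is Hermitian and the Ricci form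
of its Bismut connection vanishes. -/
def IsCYT (J : EndField I M) (g : SmoothMetric I M) : Prop :=
  IsHermitian J g ∧ ∃ D : Connection I M, IsBismut J g D ∧ RicciFormVanishes J g D

/-- The metric is invariant under the left translations of the group `M`. -/
def IsLeftInvariant [Group M] (g : SmoothMetric I M) : Prop :=
  ∀ (h x : M) (u v : TangentSpace I x),
    g.inner (h * x) (mfderiv I I (fun y ↦ h * y) x u) (mfderiv I I (fun y ↦ h * y) x v) =
      g.inner x u v

end Geometry

/-! ### The Lie group `SU(2)`, realized as the group of unit quaternions -/

instance finrank_quaternion_fact : Fact (Module.finrank ℝ ℍ[ℝ] = 3 + 1) :=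
  ⟨Quaternion.finrank_eq_four⟩

/-- The Lie group `SU(2)`, as the unit sphere of the quaternions, with quaternion multiplication
and the smooth structure of the sphere; see `su2Equiv`. -/
abbrev SU2 : Type := Metric.sphere (0 : ℍ[ℝ]) 1

instance : LieGroup (𝓡 3) ω SU2 where
  contMDiff_mul := by
    apply ContMDiff.codRestrict_sphere
    let c : SU2 → ℍ[ℝ] := (↑)
    have h₂ : ContMDiff (𝓘(ℝ, ℍ[ℝ]).prod 𝓘(ℝ, ℍ[ℝ])) 𝓘(ℝ, ℍ[ℝ]) ω
        fun z : ℍ[ℝ] × ℍ[ℝ] => z.fst * z.snd := by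
      rw [contMDiff_iff]
      exact ⟨continuous_mul, fun x y => contDiff_mul.contDiffOn⟩
    suffices h₁ : ContMDiff _ _ _ (Prod.map c c) from
      h₂.comp h₁
    apply ContMDiff.prodMap <;> exact contMDiff_coe_sphere
  contMDiff_inv := by
    have h : ∀ x : SU2, ((x⁻¹ : SU2) : ℍ[ℝ]) = star (x : ℍ[ℝ]) := fun x ↦ by
      have hx : Quaternion.normSq (x : ℍ[ℝ]) = 1 := by
        rw [Quaternion.normSq_eq_norm_mul_self, norm_eq_of_mem_sphere, mul_one]
      change ((x : ℍ[ℝ]))⁻¹ = _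
      rw [Quaternion.inv_def, hx, inv_one, one_smul]
    have h₁ : ContMDiff (𝓡 3) 𝓘(ℝ, ℍ[ℝ]) ω (fun x : SU2 ↦ star (x : ℍ[ℝ])) :=
      (LinearMap.toContinuousLinearMap (IsLinearMap.mk' (fun q : ℍ[ℝ] ↦ star q)
        ⟨star_add, fun c q ↦ by ext <;> simp⟩)).contDiff.contMDiff.comp contMDiff_coe_sphere
    have h₂ : ∀ x : SU2, star (x : ℍ[ℝ]) ∈ Metric.sphere (0 : ℍ[ℝ]) 1 := fun x ↦ by
      rw [← h]; exact (x⁻¹).2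
    exact (h₁.codRestrict_sphere h₂).congr fun x ↦ Subtype.ext (h x)

/-- The matrix `[[x + yi, z + wi], [-z + wi, x - yi]]` of the quaternion `x + yi + zj + wk`. -/
def toMatrix (q : ℍ[ℝ]) : Matrix (Fin 2) (Fin 2) ℂ :=
  !![⟨q.re, q.imI⟩, ⟨q.imJ, q.imK⟩; ⟨-q.imJ, q.imK⟩, ⟨q.re, -q.imI⟩]

/-- The inverse of `toMatrix` on `SU(2)`: the quaternion read off the first row. -/
def ofMatrix (A : Matrix (Fin 2) (Fin 2) ℂ) : ℍ[ℝ] :=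
  ⟨(A 0 0).re, (A 0 0).im, (A 0 1).re, (A 0 1).im⟩

/-- Unit quaternions are the same as special unitary `2 × 2` matrices, as a topological group. -/
def su2Equiv : SU2 ≃ₜ* Matrix.specialUnitaryGroup (Fin 2) ℂ where
  toFun q := ⟨toMatrix q, by
    have hq : Quaternion.normSq (q : ℍ[ℝ]) = 1 := by
      rw [Quaternion.normSq_eq_norm_mul_self, norm_eq_of_mem_sphere, mul_one]
    rw [Quaternion.normSq_def'] at hq
    rw [Matrix.mem_specialUnitaryGroup_iff, Matrix.mem_unitaryGroup_iff]
    constructor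
    · ext i j
      fin_cases i <;> fin_cases j <;>
        simp [toMatrix, Matrix.mul_apply, Fin.sum_univ_two, Complex.ext_iff,
          Matrix.star_apply] <;> (try constructor) <;> linarith
    · simp [toMatrix, Matrix.det_fin_two, Complex.ext_iff]
      constructor <;> linarith⟩
  invFun A := ⟨ofMatrix A.1, by
    have h := congrFun (congrFun (Matrix.mem_unitaryGroup_iff.1
      (Matrix.mem_specialUnitaryGroup_iff.1 A.2).1) 0) 0
    simp [Matrix.mul_apply, Fin.sum_univ_two, Matrix.star_apply, Complex.ext_iff] at h
    have h' : ‖ofMatrix A.1‖ * ‖ofMatrix A.1‖ = 1 := by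
      rw [← Quaternion.normSq_eq_norm_mul_self, Quaternion.normSq_def']
      simp only [ofMatrix]
      linarith [h.1]
    rw [mem_sphere_zero_iff_norm]
    nlinarith [norm_nonneg (ofMatrix A.1)]⟩
  left_inv q := by
    apply Subtype.ext
    apply Quaternion.ext <;> simp [toMatrix, ofMatrix]
  right_inv A := by
    have hu := Matrix.mem_unitaryGroup_iff.1 (Matrix.mem_specialUnitaryGroup_iff.1 A.2).1
    have hd := (Matrix.mem_specialUnitaryGroup_iff.1 A.2).2
    have hs : star A.1 = A.1.adjugate := by
      have h1 : A.1 * A.1.adjugate = 1 := by rw [Matrix.mul_adjugate, hd, one_smul]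
      have h2 : A.1.adjugate * A.1 = 1 := by rw [Matrix.adjugate_mul, hd, one_smul]
      calc star A.1 = (A.1.adjugate * A.1) * star A.1 := by rw [h2, one_mul]
        _ = A.1.adjugate := by rw [mul_assoc, hu, mul_one]
    have h00 := congrFun (congrFun hs 0) 0
    have h01 := congrFun (congrFun hs 1) 0
    simp [Matrix.adjugate_fin_two, Matrix.star_apply, Complex.ext_iff] at h00 h01
    apply Subtype.ext
    ext i j
    fin_cases i <;> fin_cases j <;> simp [toMatrix, ofMatrix, Complex.ext_iff]
    · constructor <;> linarith [h01.1, h01.2]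
    · constructor <;> linarith [h00.1, h00.2]
  map_mul' p q := by
    apply Subtype.ext
    ext i j
    fin_cases i <;> fin_cases j <;>
      simp [toMatrix, Complex.ext_iff] <;>
      constructor <;> ring
  continuous_toFun := by
    have hc : ∀ f k : ℍ[ℝ] → ℝ, Continuous f → Continuous k →
        Continuous fun q : SU2 ↦ (⟨f q, k q⟩ : ℂ) := fun f k hf hk ↦
      Complex.equivRealProdCLM.symm.continuous.comp
        ((hf.comp continuous_subtype_val).prodMk (hk.comp continuous_subtype_val))
    refine Continuous.subtype_mk (continuous_matrix fun i j ↦ ?_) _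
    have h1 := Quaternion.continuous_re
    have h2 := Quaternion.continuous_imI
    have h3 := Quaternion.continuous_imJ
    have h4 := Quaternion.continuous_imK
    fin_cases i <;> fin_cases j
    · exact hc _ _ h1 h2
    · exact hc _ _ h3 h4
    · exact hc _ _ h3.neg h4
    · exact hc _ _ h1 h2.neg
  continuous_invFun := by
    refine Continuous.subtype_mk ?_ _
    have hA : ∀ i j, Continuous fun A : Matrix.specialUnitaryGroup (Fin 2) ℂ ↦ A.1 i j :=
      fun i j ↦ continuous_subtype_val.matrix_elem i j
    refine Quaternion.linearIsometryEquivTuple.symm.continuous.comp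
      (g := Quaternion.linearIsometryEquivTuple.symm)
      (f := fun A : Matrix.specialUnitaryGroup (Fin 2) ℂ ↦
        !₂[(A.1 0 0).re, (A.1 0 0).im, (A.1 0 1).re, (A.1 0 1).im]) ?_
    refine (PiLp.continuous_toLp 2 _).comp (continuous_pi fun k ↦ ?_)
    fin_cases k
    · exact Complex.continuous_re.comp (hA 0 0)
    · exact Complex.continuous_im.comp (hA 0 0)
    · exact Complex.continuous_re.comp (hA 0 1)
    · exact Complex.continuous_im.comp (hA 0 1)

/-- The model with corners of `SU(2) × SU(2)`. -/
abbrev I₆ := (𝓡 3).prod (𝓡 3)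

/-- The Lie group `SU(2) × SU(2)`. -/
abbrev G : Type := SU2 × SU2

/-- The two projections of `SU(2) × SU(2)`. -/
def factor (i : Fin 2) (x : G) : SU2 := ![x.1, x.2] i

/-- The left-invariant Maurer-Cartan form `q⁻¹ dq` of the `i`-th factor, where `q⁻¹` is the
conjugate of the unit quaternion `q`. Its values are imaginary quaternions. -/
def maurerCartan (i : Fin 2) (x : G) (u : TangentSpace I₆ x) : ℍ[ℝ] :=
  star (factor i x : ℍ[ℝ]) * mvfderiv I₆ (fun y ↦ (factor i y : ℍ[ℝ])) x u

/-- The left-invariant form `α_i`. The forms `α_i, e_i^-, e_i^+` are `-2` times the `i, j, k`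
components of `q⁻¹ dq`. From `d(q⁻¹ dq) = - q⁻¹ dq ∧ q⁻¹ dq` one gets the Maurer-Cartan equations
`dα_i = e_i^- ∧ e_i^+`, `de_i^+ = α_i ∧ e_i^-` and `de_i^- = - α_i ∧ e_i^+`. -/
def alpha (i : Fin 2) (x : G) (u : TangentSpace I₆ x) : ℝ := -2 * (maurerCartan i x u).imI

/-- The left-invariant form `e_i^-`. -/
def eMinus (i : Fin 2) (x : G) (u : TangentSpace I₆ x) : ℝ := -2 * (maurerCartan i x u).imJ

/-- The left-invariant form `e_i^+`. -/
def ePlus (i : Fin 2) (x : G) (u : TangentSpace I₆ x) : ℝ := -2 * (maurerCartan i x u).imK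

/-- `J` is the left-invariant complex structure with `J α₁ = a α₁ + b α₂`, `J α₂ = c α₁ - a α₂`,
`J e_i^+ = e_i^-` and `J e_i^- = - e_i^+`, where `c = -(a² + 1) / b` and `J` acts on 1-forms by
`(J ξ)(u) = ξ (J u)`. (With the convention `(J ξ)(u) = - ξ (J u)` the formulas would define `-J`,
which has the same Hermitian metrics, the same Bismut connections and the same CYT metrics.) -/
structure IsStructure (a b : ℝ) (J : EndField I₆ G) : Prop where
  alpha₁ : ∀ x u, alpha 0 x (J x u) = a * alpha 0 x u + b * alpha 1 x u
  alpha₂ : ∀ x u, alpha 1 x (J x u) = -(a ^ 2 + 1) / b * alpha 0 x u - a * alpha 1 x u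
  ePlus : ∀ i x u, ePlus i x (J x u) = eMinus i x u
  eMinus : ∀ i x u, eMinus i x (J x u) = - CYT.ePlus i x u

theorem mvfderiv_factor (i : Fin 2) (x : G) (u : TangentSpace I₆ x) :
    mvfderiv I₆ (fun y ↦ (factor i y : ℍ[ℝ])) x u =
      mvfderiv (𝓡 3) ((↑) : SU2 → ℍ[ℝ]) (factor i x) (![u.1, u.2] i) := by
  have hc : ∀ q : SU2, MDifferentiableAt (𝓡 3) 𝓘(ℝ, ℍ[ℝ]) ((↑) : SU2 → ℍ[ℝ]) q := fun q ↦
    (contMDiff_coe_sphere (m := 1)).mdifferentiableAt one_ne_zero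
  fin_cases i
  · have := mfderiv_comp (I := I₆) (I' := 𝓡 3) (I'' := 𝓘(ℝ, ℍ[ℝ])) x (hc x.1)
      (mdifferentiableAt_fst (I := 𝓡 3) (I' := 𝓡 3))
    rw [mfderiv_fst] at this
    exact congrArg (fun L ↦ L u) this
  · have := mfderiv_comp (I := I₆) (I' := 𝓡 3) (I'' := 𝓘(ℝ, ℍ[ℝ])) x (hc x.2)
      (mdifferentiableAt_snd (I := 𝓡 3) (I' := 𝓡 3))
    rw [mfderiv_snd] at this
    exact congrArg (fun L ↦ L u) this

theorem maurerCartan_re (i : Fin 2) (x : G) (u : TangentSpace I₆ x) :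
    (maurerCartan i x u).re = 0 := by
  have h : mvfderiv (𝓡 3) ((↑) : SU2 → ℍ[ℝ]) (factor i x) (![u.1, u.2] i) ∈
      (ℝ ∙ ((factor i x : SU2) : ℍ[ℝ]))ᗮ := by
    rw [← range_mvfderiv_subtypeVal (n := 3)]
    exact ⟨_, rfl⟩
  rw [maurerCartan, mvfderiv_factor]
  rw [Submodule.mem_orthogonal_singleton_iff_inner_right, Quaternion.inner_def] at h
  simp at h ⊢
  linarith

/-- The six forms separate tangent vectors. -/
theorem eq_of_forms_eq {x : G} {u v : TangentSpace I₆ x} (h₀ : ∀ i, alpha i x u = alpha i x v)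
    (h₁ : ∀ i, eMinus i x u = eMinus i x v) (h₂ : ∀ i, ePlus i x u = ePlus i x v) : u = v := by
  have h : ∀ i, (![u.1, u.2] i : EuclideanSpace ℝ (Fin 3)) = ![v.1, v.2] i := fun i ↦ by
    have hm : maurerCartan i x u = maurerCartan i x v := by
      have a₀ := h₀ i
      have a₁ := h₁ i
      have a₂ := h₂ i
      simp only [alpha, eMinus, ePlus] at a₀ a₁ a₂
      apply Quaternion.ext
      · rw [maurerCartan_re, maurerCartan_re]
      all_goals linarith
    have hne : star (factor i x : ℍ[ℝ]) ≠ 0 := by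
      rw [Ne, star_eq_zero]
      exact ne_zero_of_mem_unit_sphere _
    have := mul_left_cancel₀ hne hm
    rw [mvfderiv_factor, mvfderiv_factor] at this
    exact injective_mvfderiv_subtypeVal_sphere (n := 3) (factor i x) this
  exact Prod.ext (h 0) (h 1)

/-- The coframe `(α₁, e₁^-, e₁^+, α₂, e₂^-, e₂^+)` at a point. -/
def coframe (x : G) : TangentSpace I₆ x →ₗ[ℝ] (Fin 2 → Fin 3 → ℝ) where
  toFun u i := ![alpha i x u, eMinus i x u, ePlus i x u]
  map_add' u v := by
    ext i j
    fin_cases j <;> simp [alpha, eMinus, ePlus, maurerCartan, mul_add]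
  map_smul' c u := by
    ext i j
    fin_cases j <;> simp [alpha, eMinus, ePlus, maurerCartan] <;> ring

/-- For all `a` and `b` there is exactly one `J` given by the formulas of `IsStructure`. -/
theorem existsUnique_isStructure (a b : ℝ) : ∃! J : EndField I₆ G, IsStructure a b J := by
  have hinj : ∀ x, Function.Injective (coframe x) := fun x u v h ↦
    eq_of_forms_eq (fun i ↦ congrFun (congrFun h i) 0) (fun i ↦ congrFun (congrFun h i) 1)
      (fun i ↦ congrFun (congrFun h i) 2)
  have hsurj : ∀ x, Function.Surjective (coframe x) := fun x ↦ by
    have : FiniteDimensional ℝ (TangentSpace I₆ x) :=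
      inferInstanceAs (FiniteDimensional ℝ (EuclideanSpace ℝ (Fin 3) × EuclideanSpace ℝ (Fin 3)))
    have hr : Module.finrank ℝ (TangentSpace I₆ x) = Module.finrank ℝ (Fin 2 → Fin 3 → ℝ) := by
      change Module.finrank ℝ (EuclideanSpace ℝ (Fin 3) × EuclideanSpace ℝ (Fin 3)) = _
      rw [Module.finrank_pi_fintype]
      simp
    exact (LinearMap.injective_iff_surjective_of_finrank_eq_finrank hr).1 (hinj x)
  let C : (x : G) → TangentSpace I₆ x ≃ₗ[ℝ] (Fin 2 → Fin 3 → ℝ) := fun x ↦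
    LinearEquiv.ofBijective (coframe x) ⟨hinj x, hsurj x⟩
  let A : (Fin 2 → Fin 3 → ℝ) →ₗ[ℝ] (Fin 2 → Fin 3 → ℝ) :=
    { toFun := fun f ↦ ![![a * f 0 0 + b * f 1 0, - f 0 2, f 0 1],
        ![-(a ^ 2 + 1) / b * f 0 0 - a * f 1 0, - f 1 2, f 1 1]]
      map_add' := fun f k ↦ by
        ext i j
        fin_cases i <;> fin_cases j <;> simp <;> ring
      map_smul' := fun r f ↦ by
        ext i j
        fin_cases i <;> fin_cases j <;> simp <;> ring }
  let J₀ : (x : G) → TangentSpace I₆ x →ₗ[ℝ] TangentSpace I₆ x := fun x ↦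
    (C x).symm.toLinearMap ∘ₗ A ∘ₗ (C x).toLinearMap
  let J : EndField I₆ G := fun x ↦
    ⟨J₀ x, by
      have : FiniteDimensional ℝ (TangentSpace I₆ x) :=
        inferInstanceAs (FiniteDimensional ℝ (EuclideanSpace ℝ (Fin 3) × EuclideanSpace ℝ (Fin 3)))
      have : T2Space (TangentSpace I₆ x) :=
        inferInstanceAs (T2Space (EuclideanSpace ℝ (Fin 3) × EuclideanSpace ℝ (Fin 3)))
      exact LinearMap.continuous_of_finiteDimensional (J₀ x)⟩
  have hJ : ∀ x u, coframe x (J x u) = A (coframe x u) := fun x u ↦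
    (C x).apply_symm_apply (A (C x u))
  refine ⟨J, ⟨fun x u ↦ congrFun (congrFun (hJ x u) 0) 0, fun x u ↦
    congrFun (congrFun (hJ x u) 1) 0, fun i x u ↦ ?_, fun i x u ↦ ?_⟩, fun K hK ↦ ?_⟩
  · have := congrFun (congrFun (hJ x u) i) 2
    fin_cases i <;> exact this
  · have := congrFun (congrFun (hJ x u) i) 1
    fin_cases i <;> exact this
  · funext x
    ext1 u
    apply hinj x
    rw [hJ]
    ext i j
    fin_cases i <;> fin_cases j
    · exact hK.alpha₁ x u
    · exact hK.eMinus 0 x u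
    · exact hK.ePlus 0 x u
    · exact hK.alpha₂ x u
    · exact hK.eMinus 1 x u
    · exact hK.ePlus 1 x u

end CYT

end

/-!
A left-invariant metric is an inner product on the Lie algebra, and its Bismut connection is
left-invariant by uniqueness, so it is given by a constant tensor `Γ`. Its Ricci form on
left-invariant fields is `tr (J Γ [u, v])` up to sign, and the Lie algebra is perfect, so the
metric is CYT exactly when `tr (J Γ u) = 0` for all `u`.

The skew torsion gives `tr (J Γ u) = tr (J ad u) + tr (ad (J u)) + ∑ ⟨[e_k, J e_k], u⟩`. Here
`tr (ad (J u)) = 0` and `tr (J ad u) = 2 (α₁ + α₂) u`, so the vector `∑ [e_k, J e_k]` of a CYT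
metric is dual to `-2 (α₁ + α₂)`. Evaluating `α_i` on it gives
`⟨α_i, α₁ + α₂⟩ = (|e_i^-|² + |e_i^+|²) / 2 > 0` in the dual inner product. Since `J` is an
isometry, `⟨α₁, J α₁⟩ = 0` and `|J α₁| = |α₁|` express these products through `|α₁|²`, and the two
inequalities follow. Conversely, for the explicit metric of `cytForm` the connection is a 1-form
times a rotation `R` with `tr (J R) = 0`.
-/

noncomputable section

namespace CYT

section Calculus

open VectorField

variable {E : Type*} [NormedAddCommGroup E] [NormedSpace ℝ E]
  {H : Type*} [TopologicalSpace H] {I : ModelWithCorners ℝ E H}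
  {M : Type*} [TopologicalSpace M] [ChartedSpace H M]
  {F F' F'' : Type*} [NormedAddCommGroup F] [NormedSpace ℝ F] [NormedAddCommGroup F']
  [NormedSpace ℝ F'] [NormedAddCommGroup F''] [NormedSpace ℝ F'']

theorem mvfderiv_bilinear (B : F →L[ℝ] F' →L[ℝ] F'') {f : M → F} {k : M → F'} {x : M}
    (hf : MDifferentiableAt I 𝓘(ℝ, F) f x) (hk : MDifferentiableAt I 𝓘(ℝ, F') k x)
    (u : TangentSpace I x) :
    mvfderiv I (fun y ↦ B (f y) (k y)) x u =
      B (mvfderiv I f x u) (k x) + B (f x) (mvfderiv I k x u) := by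
  have h : HasMFDerivAt I 𝓘(ℝ, F'') (fun y ↦ B (f y) (k y)) x
      (B.precompR E (f x) (mfderiv I 𝓘(ℝ, F') k x) +
        B.precompL E (mfderiv I 𝓘(ℝ, F) f x) (k x)) := by
    refine ⟨(B.continuous.continuousAt.comp hf.continuousAt).clm_apply hk.continuousAt, ?_⟩
    have := B.hasFDerivWithinAt_of_bilinear hf.hasMFDerivAt.2 hk.hasMFDerivAt.2
    simpa [writtenInExtChartAt] using! this
  exact (congrArg (fun L : TangentSpace I x →L[ℝ] F'' ↦ L u) h.mfderiv).trans (add_comm _ _)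

theorem mdifferentiableAt_bilinear (B : F →L[ℝ] F' →L[ℝ] F'') {f : M → F} {k : M → F'} {x : M}
    (hf : MDifferentiableAt I 𝓘(ℝ, F) f x) (hk : MDifferentiableAt I 𝓘(ℝ, F') k x) :
    MDifferentiableAt I 𝓘(ℝ, F'') (fun y ↦ B (f y) (k y)) x :=
  ((B.contMDiff (n := 1)).mdifferentiableAt one_ne_zero |>.comp x hf).clm_apply hk

theorem contMDiffAt_bilinear (B : F →L[ℝ] F' →L[ℝ] F'') {n : WithTop ℕ∞} {f : M → F} {k : M → F'}
    {x : M} (hf : ContMDiffAt I 𝓘(ℝ, F) n f x) (hk : ContMDiffAt I 𝓘(ℝ, F') n k x) :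
    ContMDiffAt I 𝓘(ℝ, F'') n (fun y ↦ B (f y) (k y)) x :=
  (B.contMDiff.contMDiffAt.comp x hf).clm_apply hk

theorem mvfderiv_clm_comp (L : F →L[ℝ] F') {f : M → F} {x : M}
    (hf : MDifferentiableAt I 𝓘(ℝ, F) f x) (u : TangentSpace I x) :
    mvfderiv I (fun y ↦ L (f y)) x u = L (mvfderiv I f x u) := by
  have h : HasMFDerivAt I 𝓘(ℝ, F') (fun y ↦ L (f y)) x (L ∘L (mfderiv I 𝓘(ℝ, F) f x)) :=
    L.hasMFDerivAt.comp x hf.hasMFDerivAt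
  exact congrArg (fun L : TangentSpace I x →L[ℝ] F' ↦ L u) h.mfderiv

theorem contMDiffAt_clm_of_apply [FiniteDimensional ℝ F] {n : WithTop ℕ∞} {f : M → F →L[ℝ] F'}
    {x : M} (h : ∀ v, ContMDiffAt I 𝓘(ℝ, F') n (fun y ↦ f y v) x) :
    ContMDiffAt I 𝓘(ℝ, F →L[ℝ] F') n f x := by
  let e := Module.finBasis ℝ F
  let c i : F →L[ℝ] ℝ := LinearMap.toContinuousLinearMap (e.coord i)
  have hf : f = fun y ↦ ∑ i, ContinuousLinearMap.smulRightL ℝ F F' (c i) (f y (e i)) := by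
    funext y
    ext v
    conv_lhs => rw [← e.sum_repr v, map_sum]
    simp [c]
  rw [hf]
  exact contMDiffAt_finsetSum fun i _ ↦
    (ContinuousLinearMap.smulRightL ℝ F F' (c i)).contMDiff.contMDiffAt.comp x (h (e i))

variable [IsManifold I ∞ M]

theorem contMDiffAt_mvfderiv_apply {f : M → F} (hf : ContMDiff I 𝓘(ℝ, F) ∞ f)
    {Y : (x : M) → TangentSpace I x} {x : M}
    (hY : ContMDiffAt I I.tangent ∞ (fun y ↦ (⟨y, Y y⟩ : TangentBundle I M)) x) :
    ContMDiffAt I 𝓘(ℝ, F) ∞ (fun y ↦ mvfderiv I f y (Y y)) x := by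
  have h : ContMDiff I.tangent 𝓘(ℝ, F).tangent ∞ (tangentMap I 𝓘(ℝ, F) f) :=
    hf.contMDiff_tangentMap (m := ∞) (by simp)
  exact ((contMDiff_snd_tangentBundle_modelSpace F 𝓘(ℝ, F)).comp h).contMDiffAt.comp x hY

variable {X Y Z : VField I M}

theorem SmoothField.mdifferentiableAt (hX : SmoothField X) (x : M) :
    MDifferentiableAt I I.tangent (fun y ↦ (⟨y, X y⟩ : TangentBundle I M)) x :=
  (hX x).mdifferentiableAt (by simp)

theorem SmoothField.smul (hX : SmoothField X) {f : M → ℝ} (hf : ContMDiff I 𝓘(ℝ, ℝ) ∞ f) :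
    SmoothField (f • X) :=
  ContMDiff.smul_section hf hX

theorem SmoothField.contMDiff_mvfderiv (hX : SmoothField X) {f : M → F}
    (hf : ContMDiff I 𝓘(ℝ, F) ∞ f) : ContMDiff I 𝓘(ℝ, F) ∞ (fun y ↦ mvfderiv I f y (X y)) :=
  fun x ↦ contMDiffAt_mvfderiv_apply hf (hX x)

variable [FiniteDimensional ℝ E]

theorem SmoothField.mlieBracket (hX : SmoothField X) (hY : SmoothField Y) :
    SmoothField (mlieBracket I X Y) := by
  intro x
  have : IsManifold I ((⊤ : ℕ∞) + 1) M := inferInstanceAs (IsManifold I ∞ M)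
  have : IsManifold I (minSmoothness ℝ 2) M := by
    rw [minSmoothness_of_isRCLikeNormedField]; infer_instance
  exact ContMDiffAt.mlieBracket_vectorField (m := ⊤) (n := ⊤) (hX x) (hY x) (by simp)

theorem mlieBracket_mlieBracket_smul (hY : SmoothField Y)
    (hZ : SmoothField Z) {f : M → ℝ} (hf : ContMDiff I 𝓘(ℝ, ℝ) ∞ f) (x : M) :
    mlieBracket I X (mlieBracket I Y (f • Z)) x =
      mvfderiv I (fun y ↦ mvfderiv I f y (Y y)) x (X x) • Z x +
        mvfderiv I f x (Y x) • mlieBracket I X Z x +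
        (mvfderiv I f x (X x) • mlieBracket I Y Z x +
          f x • mlieBracket I X (mlieBracket I Y Z) x) := by
  have hdiff {k : M → ℝ} (hk : ContMDiff I 𝓘(ℝ, ℝ) ∞ k) y : MDifferentiableAt I 𝓘(ℝ, ℝ) k y :=
    (hk y).mdifferentiableAt (by simp)
  have hYf := hY.contMDiff_mvfderiv hf
  have hYZ := hY.mlieBracket hZ
  have inner : mlieBracket I Y (f • Z) =
      (fun y ↦ mvfderiv I f y (Y y)) • Z + f • mlieBracket I Y Z :=
    funext fun y ↦ mlieBracket_smul_right (hdiff hf y) (hZ.mdifferentiableAt y)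
  rw [inner, mlieBracket_add_right ((hZ.smul hYf).mdifferentiableAt x)
      ((hYZ.smul hf).mdifferentiableAt x),
    mlieBracket_smul_right (hdiff hYf x) (hZ.mdifferentiableAt x),
    mlieBracket_smul_right (hdiff hf x) (hYZ.mdifferentiableAt x)]

-- Compare the coefficients of `Z` in the Jacobi identity for `X`, `Y` and `f • Z`.
theorem mvfderiv_mlieBracket_of_ne_zero (hX : SmoothField X) (hY : SmoothField Y)
    (hZ : SmoothField Z) {f : M → ℝ} (hf : ContMDiff I 𝓘(ℝ, ℝ) ∞ f) {x : M} (hx : Z x ≠ 0) :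
    mvfderiv I f x (mlieBracket I X Y x) =
      mvfderiv I (fun y ↦ mvfderiv I f y (Y y)) x (X x) -
        mvfderiv I (fun y ↦ mvfderiv I f y (X y)) x (Y x) := by
  have : IsManifold I (minSmoothness ℝ 3) M := by
    rw [minSmoothness_of_isRCLikeNormedField]; infer_instance
  have regular {W : VField I M} (hW : SmoothField W) :
      ContMDiffAt I I.tangent (minSmoothness ℝ 2) (fun y ↦ (⟨y, W y⟩ : TangentBundle I M)) x :=
    (hW x).of_le (by rw [minSmoothness_of_isRCLikeNormedField]; exact ENat.LEInfty.out)
  have jacobi_smul :=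
    leibniz_identity_mlieBracket_apply (regular hX) (regular hY) (regular (hZ.smul hf))
  have jacobi := leibniz_identity_mlieBracket_apply (regular hX) (regular hY) (regular hZ)
  rw [mlieBracket_mlieBracket_smul hY hZ hf, mlieBracket_mlieBracket_smul hX hZ hf,
    mlieBracket_smul_right ((hf x).mdifferentiableAt (by simp)) (hZ.mdifferentiableAt x), jacobi,
    smul_add] at jacobi_smul
  have : (mvfderiv I f x (mlieBracket I X Y x) -
      (mvfderiv I (fun y ↦ mvfderiv I f y (Y y)) x (X x) -
        mvfderiv I (fun y ↦ mvfderiv I f y (X y)) x (Y x))) • Z x = 0 := by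
    rw [sub_smul, sub_smul, sub_eq_zero, eq_comm, sub_eq_iff_eq_add, ← sub_eq_zero,
      ← sub_eq_zero.2 jacobi_smul]
    abel
  exact sub_eq_zero.1 ((smul_eq_zero.1 this).resolve_right hx)

theorem mvfderiv_mlieBracket_real (hX : SmoothField X) (hY : SmoothField Y) {f : M → ℝ}
    (hf : ContMDiff I 𝓘(ℝ, ℝ) ∞ f) (x : M) :
    mvfderiv I f x (mlieBracket I X Y x) =
      mvfderiv I (fun y ↦ mvfderiv I f y (Y y)) x (X x) -
        mvfderiv I (fun y ↦ mvfderiv I f y (X y)) x (Y x) := by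
  by_cases hXx : X x = 0
  · by_cases hYx : Y x = 0
    · by_cases hXY : VectorField.mlieBracket I X Y x = 0
      · simp only [hXx, hYx, hXY, map_zero, sub_self]
      · exact mvfderiv_mlieBracket_of_ne_zero hX hY (hX.mlieBracket hY) hf hXY
    · exact mvfderiv_mlieBracket_of_ne_zero hX hY hY hf hYx
  · exact mvfderiv_mlieBracket_of_ne_zero hX hY hX hf hXx

theorem mvfderiv_mlieBracket (hX : SmoothField X) (hY : SmoothField Y) {f : M → F}
    (hf : ContMDiff I 𝓘(ℝ, F) ∞ f) (x : M) :
    mvfderiv I f x (mlieBracket I X Y x) =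
      mvfderiv I (fun y ↦ mvfderiv I f y (Y y)) x (X x) -
        mvfderiv I (fun y ↦ mvfderiv I f y (X y)) x (Y x) := by
  have hdiff {k : M → F} (hk : ContMDiff I 𝓘(ℝ, F) ∞ k) y : MDifferentiableAt I 𝓘(ℝ, F) k y :=
    (hk y).mdifferentiableAt (by simp)
  refine (SeparatingDual.eq_iff_forall_dual_eq (R := ℝ)).2 fun L ↦ ?_
  have h := mvfderiv_mlieBracket_real hX hY (f := fun y ↦ L (f y)) (L.contMDiff.comp hf) x
  simp only [mvfderiv_clm_comp L (hdiff hf _)] at h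
  rw [h, map_sub, mvfderiv_clm_comp L (hdiff (hY.contMDiff_mvfderiv hf) x),
    mvfderiv_clm_comp L (hdiff (hX.contMDiff_mvfderiv hf) x)]

end Calculus

section LinearAlgebra

open Module

variable {V : Type*} [AddCommGroup V] [Module ℝ V] {B : V →ₗ[ℝ] V →ₗ[ℝ] ℝ}
  {J : V →ₗ[ℝ] V} {ι : Type*}

/-- `B` is an inner product: it is symmetric and positive definite. -/
structure IsInnerProduct (B : V →ₗ[ℝ] V →ₗ[ℝ] ℝ) : Prop where
  symm : ∀ v w, B v w = B w v
  pos : ∀ v, v ≠ 0 → 0 < B v v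

/-- `B` is an inner product that is Hermitian with respect to `J`. The condition is stated as
skew-symmetry of `J`, which amounts to `B (J v) (J w) = B v w` when `J² = -1`. -/
structure IsHermitianForm (B : V →ₗ[ℝ] V →ₗ[ℝ] ℝ) (J : V →ₗ[ℝ] V) : Prop
    extends IsInnerProduct B where
  skew : ∀ v w, B (J v) w = -B v (J w)

theorem IsHermitianForm.apply_apply (h : IsHermitianForm B J) (hJ : ∀ v, J (J v) = -v) (v w : V) :
    B (J v) (J w) = B v w := by
  rw [h.skew, hJ, map_neg, neg_neg]

/-- The family `e` is orthonormal for the bilinear form `B`, which is not tied to a norm on `V`. -/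
def IsOrthonormal [DecidableEq ι] (B : V →ₗ[ℝ] V →ₗ[ℝ] ℝ) (e : ι → V) : Prop :=
  ∀ i j, B (e i) (e j) = if i = j then 1 else 0

theorem IsInnerProduct.exists_basis_isOrthonormal [FiniteDimensional ℝ V]
    (hB : IsInnerProduct B) : ∃ e : Basis (Fin (finrank ℝ V)) ℝ V, IsOrthonormal B e := by
  obtain ⟨v, hv⟩ := LinearMap.BilinForm.exists_orthogonal_basis (B := B) ⟨hB.symm⟩
  have norm_pos i : 0 < √(B (v i) (v i)) := Real.sqrt_pos.2 (hB.pos _ (v.ne_zero i))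
  refine ⟨v.isUnitSMul fun i ↦ (inv_ne_zero (norm_pos i).ne').isUnit, fun i j ↦ ?_⟩
  simp only [Basis.isUnitSMul_apply, map_smul, LinearMap.smul_apply, smul_eq_mul]
  split_ifs with h
  · subst h
    have := Real.mul_self_sqrt (hB.pos _ (v.ne_zero i)).le
    have h0 := (norm_pos i).ne'
    field_simp
    rw [sq, this]
  · rw [show B (v i) (v j) = 0 from hv h]
    simp

namespace IsOrthonormal

variable [DecidableEq ι]

theorem repr_eq {e : Basis ι ℝ V} (he : IsOrthonormal B e) (v : V) (i : ι) :
    e.repr v i = B v (e i) := by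
  have coord_eq : e.coord i = B.flip (e i) := e.ext fun j ↦ by
    simp [he j i, Finsupp.single_apply]
  exact LinearMap.congr_fun coord_eq v

variable [Fintype ι]

theorem exists_basis_eq [FiniteDimensional ℝ V] {v : ι → V} (hv : IsOrthonormal B v)
    (hι : Fintype.card ι = finrank ℝ V) : ∃ e : Basis ι ℝ V, ⇑e = v := by
  have hli : LinearIndependent ℝ v := by
    rw [Fintype.linearIndependent_iff]
    intro c hc i
    simpa [hv _ _] using congrArg (fun w ↦ B w (v i)) hc
  exact ⟨basisOfLinearIndependentOfCardEqFinrank' v hli hι,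
    coe_basisOfLinearIndependentOfCardEqFinrank' ..⟩

variable {e : Basis ι ℝ V} (he : IsOrthonormal B e)
include he

theorem sum_smul (v : V) : ∑ i, B v (e i) • e i = v := by
  simp only [← he.repr_eq, e.sum_repr]

theorem trace_eq_sum (T : V →ₗ[ℝ] V) : LinearMap.trace ℝ V T = ∑ i, B (T (e i)) (e i) := by
  rw [LinearMap.trace_eq_matrix_trace ℝ e, Matrix.trace]
  simp [LinearMap.toMatrix_apply, he.repr_eq]

variable (hB : IsHermitianForm B J)
include hB

theorem sum_skew (β : V →ₗ[ℝ] V →ₗ[ℝ] ℝ) :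
    ∑ k, β (J (e k)) (e k) = -∑ k, β (e k) (J (e k)) := by
  have left k : β (J (e k)) (e k) = ∑ l, B (J (e k)) (e l) * β (e l) (e k) := by
    conv_lhs => rw [← he.sum_smul (J (e k))]
    simp
  have right k : β (e k) (J (e k)) = ∑ l, B (J (e k)) (e l) * β (e k) (e l) := by
    conv_lhs => rw [← he.sum_smul (J (e k))]
    simp
  simp only [left, right]
  rw [Finset.sum_comm, ← Finset.sum_neg_distrib]
  refine Finset.sum_congr rfl fun k _ ↦ ?_
  rw [← Finset.sum_neg_distrib]
  refine Finset.sum_congr rfl fun l _ ↦ ?_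
  rw [hB.skew (e l), hB.symm]
  ring

theorem sum_apply_complex (T : V →ₗ[ℝ] V) :
    ∑ k, B (T (e k)) (J (e k)) = -LinearMap.trace ℝ V (J ∘ₗ T) := by
  simp only [he.trace_eq_sum, LinearMap.comp_apply, hB.skew, Finset.sum_neg_distrib, neg_neg]

end IsOrthonormal

/-- The bilinear form on the dual space for which `e` is a Parseval frame. If `e` is orthonormal
for an inner product, this is the dual inner product. -/
def cometric [Fintype ι] (e : ι → V) : Dual ℝ V →ₗ[ℝ] Dual ℝ V →ₗ[ℝ] ℝ :=
  ∑ k, (Dual.eval ℝ V (e k)).smulRight (Dual.eval ℝ V (e k))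

section Cometric

variable [Fintype ι]

theorem cometric_apply (e : ι → V) (φ ψ : Dual ℝ V) :
    cometric e φ ψ = ∑ k, φ (e k) * ψ (e k) := by
  simp [cometric, LinearMap.sum_apply]

theorem cometric_comm (e : ι → V) (φ ψ : Dual ℝ V) : cometric e φ ψ = cometric e ψ φ := by
  simp only [cometric_apply, mul_comm]

theorem cometric_self_pos (e : Basis ι ℝ V) {φ : Dual ℝ V} (hφ : φ ≠ 0) :
    0 < cometric e φ φ := by
  obtain ⟨k, hk⟩ : ∃ k, φ (e k) ≠ 0 := by
    by_contra! h
    exact hφ (e.ext h)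
  rw [cometric_apply]
  exact Finset.sum_pos' (fun k _ ↦ mul_self_nonneg _) ⟨k, Finset.mem_univ k, mul_self_pos.2 hk⟩

variable [DecidableEq ι] {e : Basis ι ℝ V}

theorem IsOrthonormal.cometric_apply_left (he : IsOrthonormal B e) (φ : Dual ℝ V) (v : V) :
    cometric e φ (B v) = φ v := by
  conv_rhs => rw [← he.sum_smul v]
  simp [cometric_apply, mul_comm]

theorem IsOrthonormal.cometric_comp_complex (he : IsOrthonormal B e) (hB : IsHermitianForm B J)
    (φ ψ : Dual ℝ V) : cometric e (φ ∘ₗ J) ψ = -cometric e φ (ψ ∘ₗ J) := by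
  simpa [cometric_apply] using he.sum_skew hB (φ.smulRight ψ)

end Cometric

/-- The algebraic properties of the Bismut connection of a left-invariant Hermitian structure on a
Lie group: `Γ` gives the covariant derivatives of left-invariant fields and `br` their brackets. -/
structure IsAlgBismut (B : V →ₗ[ℝ] V →ₗ[ℝ] ℝ) (J : V →ₗ[ℝ] V) (br Γ : V →ₗ[ℝ] V →ₗ[ℝ] V) :
    Prop where
  metric : ∀ u v w, B (Γ u v) w + B v (Γ u w) = 0
  complex : ∀ u v, Γ u (J v) = J (Γ u v)
  skew : ∀ u v w, B (Γ u v - Γ v u - br u v) w = -B (Γ u w - Γ w u - br u w) v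

namespace IsAlgBismut

variable {br Γ Γ' : V →ₗ[ℝ] V →ₗ[ℝ] V}

-- The difference of two such connections, lowered to a trilinear form, is skew in its last two
-- arguments and invariant under cyclic permutations; complex linearity then makes it vanish.
theorem unique (hB : IsHermitianForm B J) (hJ : ∀ v, J (J v) = -v) (h : IsAlgBismut B J br Γ)
    (h' : IsAlgBismut B J br Γ') : Γ = Γ' := by
  let d u v w : ℝ := B (Γ u v - Γ' u v) w
  have skew u v w : d u v w = -d u w v := by
    have h1 := h.metric u v w
    have h2 := h'.metric u v w
    simp only [d, map_sub, LinearMap.sub_apply]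
    rw [hB.symm (Γ u w), hB.symm (Γ' u w)]
    linarith
  have cyclic u v w : d v u w = d w v u := by
    have h1 := h.skew u v w
    have h2 := h'.skew u v w
    have h3 := skew u v w
    have h4 := skew w u v
    simp only [d, map_sub, LinearMap.sub_apply] at h1 h2 h3 h4 ⊢
    linarith
  have complex₂ u v w : d u (J v) w = -d u v (J w) := by
    simp only [d, h.complex, h'.complex, ← map_sub]
    exact hB.skew _ _
  have complex₁ u v w : d (J u) v w = d u v (J w) := by
    rw [cyclic v (J u) w, complex₂ w u v, cyclic u w (J v), cyclic w (J v) u, complex₂, neg_neg]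
  have vanish u v w : d u v (J w) = 0 := by
    linarith [complex₁ u v w, complex₁ u w v, skew (J u) v w, skew u w (J v), complex₂ u v w]
  ext u v
  by_contra hne
  have := vanish u v (-J (Γ u v - Γ' u v))
  simp only [map_neg, hJ, neg_neg] at this
  exact (hB.pos _ (sub_ne_zero.2 hne)).ne' this

section Trace

variable [Fintype ι] [DecidableEq ι] {e : Basis ι ℝ V} (hB : IsHermitianForm B J)
  (he : IsOrthonormal B e) (h : IsAlgBismut B J br Γ)
include hB he h

theorem sum_metric_apply (u : V) :
    ∑ k, B (Γ (e k) u) (e k) = -LinearMap.trace ℝ V (br u) := by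
  rw [he.trace_eq_sum, ← Finset.sum_neg_distrib]
  refine Finset.sum_congr rfl fun k _ ↦ ?_
  have torsion := h.skew u (e k) (e k)
  have metric := h.metric u (e k) (e k)
  rw [hB.symm (e k)] at metric
  simp only [map_sub, LinearMap.sub_apply] at torsion
  linarith

theorem sum_metric_complex_apply (u : V) :
    ∑ k, B (Γ (J (e k)) u) (e k) = -LinearMap.trace ℝ V (br (J u)) := by
  have swap : ∑ k, B (Γ (J (e k)) u) (e k) = -∑ k, B (Γ (e k) u) (J (e k)) :=
    he.sum_skew hB (B ∘ₗ Γ.flip u)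
  have complex k : B (Γ (e k) u) (J (e k)) = -B (Γ (e k) (J u)) (e k) := by
    rw [h.complex, hB.skew, neg_neg]
  simp only [swap, complex, Finset.sum_neg_distrib, neg_neg]
  exact h.sum_metric_apply hB he (J u)

theorem trace_comp (hbr : ∀ u v, br u v = -br v u) (u : V) :
    LinearMap.trace ℝ V (J ∘ₗ Γ u) = LinearMap.trace ℝ V (J ∘ₗ br u) +
      LinearMap.trace ℝ V (br (J u)) + ∑ k, B (br (e k) (J (e k))) u := by
  have koszul k : B (Γ u (e k)) (J (e k)) =
      B (br u (e k)) (J (e k)) - B (br (e k) (J (e k))) u + B (Γ (J (e k)) u) (e k) := by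
    have torsion := h.skew (e k) u (J (e k))
    have metric₁ := h.metric (e k) (J (e k)) u
    have metric₂ := h.metric (J (e k)) (e k) u
    rw [hbr (e k) u] at torsion
    rw [hB.symm (J (e k))] at metric₁
    rw [hB.symm (e k)] at metric₂
    simp only [map_sub, LinearMap.sub_apply, map_neg, LinearMap.neg_apply] at torsion
    linarith
  have sum_koszul := he.sum_apply_complex hB (Γ u)
  simp only [koszul] at sum_koszul
  rw [Finset.sum_add_distrib, Finset.sum_sub_distrib, he.sum_apply_complex hB (br u),
    h.sum_metric_complex_apply hB he] at sum_koszul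
  linarith

theorem sum_curvature (u v : V) :
    ∑ k, B (Γ u (Γ v (e k)) - Γ v (Γ u (e k)) - Γ (br u v) (e k)) (J (e k)) =
      LinearMap.trace ℝ V (J ∘ₗ Γ (br u v)) := by
  have commutes : LinearMap.trace ℝ V (J ∘ₗ Γ u ∘ₗ Γ v) =
      LinearMap.trace ℝ V (J ∘ₗ Γ v ∘ₗ Γ u) := by
    have : J ∘ₗ Γ u ∘ₗ Γ v = Γ u * (J ∘ₗ Γ v) :=
      LinearMap.ext fun w ↦ (h.complex u (Γ v w)).symm
    rw [this, LinearMap.trace_mul_comm]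
    rfl
  have := he.sum_apply_complex hB (Γ u ∘ₗ Γ v - Γ v ∘ₗ Γ u - Γ (br u v))
  simp only [LinearMap.sub_apply, LinearMap.comp_apply] at this
  rw [this, LinearMap.comp_sub, LinearMap.comp_sub, map_sub, map_sub, commutes, sub_self, zero_sub,
    neg_neg]

end Trace

end IsAlgBismut

end LinearAlgebra

theorem IsInnerProduct.isVonNBounded {V : Type*} [NormedAddCommGroup V] [NormedSpace ℝ V]
    [FiniteDimensional ℝ V] {B : V →ₗ[ℝ] V →ₗ[ℝ] ℝ} (hB : IsInnerProduct B) :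
    Bornology.IsVonNBounded ℝ {v : V | B v v < 1} := by
  obtain ⟨e, he⟩ := hB.exists_basis_isOrthonormal
  rw [NormedSpace.isVonNBounded_iff, isBounded_iff_forall_norm_le]
  refine ⟨∑ i, ‖e i‖, fun v hv ↦ ?_⟩
  have parseval : B v v = ∑ i, B v (e i) ^ 2 := by
    nth_rw 2 [← he.sum_smul v]
    simp [sq]
  have coord_le i : |B v (e i)| ≤ 1 := by
    rw [← sq_le_one_iff_abs_le_one]
    refine le_trans ?_ (parseval ▸ le_of_lt hv : ∑ i, B v (e i) ^ 2 ≤ 1)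
    exact Finset.single_le_sum (f := fun i ↦ B v (e i) ^ 2) (fun i _ ↦ sq_nonneg _)
      (Finset.mem_univ i)
  calc ‖v‖ = ‖∑ i, B v (e i) • e i‖ := by rw [he.sum_smul v]
    _ ≤ ∑ i, ‖B v (e i) • e i‖ := norm_sum_le _ _
    _ ≤ ∑ i, ‖e i‖ := Finset.sum_le_sum fun i _ ↦ by
      rw [norm_smul, Real.norm_eq_abs]
      exact mul_le_of_le_one_left (norm_nonneg _) (coord_le i)


section Framing

open VectorField Module

variable {E : Type*} [NormedAddCommGroup E] [NormedSpace ℝ E]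
  {H : Type*} [TopologicalSpace H] {I : ModelWithCorners ℝ E H}
  {M : Type*} [TopologicalSpace M] [ChartedSpace H M] [IsManifold I ∞ M]
  {V : Type*} [NormedAddCommGroup V] [NormedSpace ℝ V] {br : V →ₗ[ℝ] V →ₗ[ℝ] V}

variable (I M) in
/-- A smooth framing of the tangent bundle of `M`, given as a 1-form `θ` with values in `V` that is
an isomorphism at every point, with constant structure functions: `dθ(X, Y) = -br (θ X) (θ Y)`.
For a Lie group this is the Maurer-Cartan form, and `br` is the bracket of the Lie algebra. -/
structure LieFraming (br : V →ₗ[ℝ] V →ₗ[ℝ] V) where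
  form (x : M) : TangentSpace I x ≃L[ℝ] V
  contMDiffAt_form (Y : VField I M) (x : M) :
    ContMDiffAt I I.tangent ∞ (fun y ↦ (⟨y, Y y⟩ : TangentBundle I M)) x →
      ContMDiffAt I 𝓘(ℝ, V) ∞ (fun y ↦ form y (Y y)) x
  form_mlieBracket (X Y : VField I M) (x : M) : SmoothField X → SmoothField Y →
    form x (mlieBracket I X Y x) = mvfderiv I (fun y ↦ form y (Y y)) x (X x) -
      mvfderiv I (fun y ↦ form y (X y)) x (Y x) + br (form x (X x)) (form x (Y x))

namespace LieFraming

instance : CoeFun (LieFraming I M br) fun _ ↦ (x : M) → TangentSpace I x ≃L[ℝ] V := ⟨form⟩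

variable (θ : LieFraming I M br)

theorem contMDiff_form {Y : VField I M} (hY : SmoothField Y) :
    ContMDiff I 𝓘(ℝ, V) ∞ (fun y ↦ θ y (Y y)) :=
  fun x ↦ θ.contMDiffAt_form Y x (hY x)

/-- The form `θ` near `x`, read in the trivialization of the tangent bundle at `x`. -/
def localForm (x y : M) : E →L[ℝ] V :=
  (θ y : TangentSpace I y →L[ℝ] V) ∘L (trivializationAt E (TangentSpace I) x).symmL ℝ y

/-- The field on which `θ` takes the constant value `v`. -/
def frameField (v : V) : VField I M := fun x ↦ (θ x).symm v

@[simp]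
theorem form_frameField (v : V) (x : M) : θ x (θ.frameField v x) = v :=
  (θ x).apply_symm_apply v

@[simp]
theorem frameField_form {x : M} (u : TangentSpace I x) : θ.frameField (θ x u) x = u :=
  (θ x).symm_apply_apply u

theorem frameField_add (v w : V) : θ.frameField (v + w) = θ.frameField v + θ.frameField w :=
  funext fun x ↦ map_add (θ x).symm v w

theorem frameField_smul (c : ℝ) (v : V) : θ.frameField (c • v) = c • θ.frameField v :=
  funext fun x ↦ map_smul (θ x).symm c v

theorem localForm_eq {x y : M}
    (hy : y ∈ (trivializationAt E (TangentSpace I : M → Type _) x).baseSet) :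
    θ.localForm x y = (((trivializationAt E (TangentSpace I) x).continuousLinearEquivAt ℝ y hy).symm
      |>.trans (θ y) : E ≃L[ℝ] V) := by
  rw [localForm, ← Bundle.Trivialization.symm_continuousLinearEquivAt_eq' _ hy]
  rfl

theorem localForm_trivialization {x y : M}
    (hy : y ∈ (trivializationAt E (TangentSpace I : M → Type _) x).baseSet) (u : TangentSpace I y) :
    θ.localForm x y (trivializationAt E (TangentSpace I) x ⟨y, u⟩).2 = θ y u := by
  rw [θ.localForm_eq hy, Bundle.Trivialization.apply_eq_prod_continuousLinearEquivAt ℝ _ y hy]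
  exact congrArg (θ y) (ContinuousLinearEquiv.symm_apply_apply _ u)

variable [FiniteDimensional ℝ E]

theorem contMDiffAt_localForm (x : M) : ContMDiffAt I 𝓘(ℝ, E →L[ℝ] V) ∞ (θ.localForm x) x := by
  refine contMDiffAt_clm_of_apply fun v ↦ θ.contMDiffAt_form _ x ?_
  let t := trivializationAt E (TangentSpace I : M → Type _) x
  have hx : x ∈ t.baseSet := FiberBundle.mem_baseSet_trivializationAt' x
  have constant : ContMDiffAt I (I.prod 𝓘(ℝ, E)) ∞ (fun y : M ↦ (y, v)) x :=
    contMDiffAt_id.prodMk contMDiffAt_const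
  have symm := (t.contMDiffOn_symm (IB := I) (n := ∞)).contMDiffAt (x := (x, v))
    (t.open_target.mem_nhds (t.mem_target.2 hx))
  refine (symm.comp x constant).congr_of_eventuallyEq ?_
  filter_upwards [t.open_baseSet.mem_nhds hx] with y hy
  exact (congrArg (Bundle.TotalSpace.mk y) (t.symmL_apply hy v)).trans (t.mk_symm hy v)

theorem mdifferentiableAt_form {Y : VField I M} {x : M}
    (hY : MDifferentiableAt I I.tangent (fun y ↦ (⟨y, Y y⟩ : TangentBundle I M)) x) :
    MDifferentiableAt I 𝓘(ℝ, V) (fun y ↦ θ y (Y y)) x := by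
  refine (((θ.contMDiffAt_localForm x).mdifferentiableAt (by simp)).clm_apply
    ((mdifferentiableAt_section ..).1 hY)).congr_of_eventuallyEq ?_
  filter_upwards [(trivializationAt E (TangentSpace I : M → Type _) x).open_baseSet.mem_nhds
    (FiberBundle.mem_baseSet_trivializationAt' x)] with y hy
  exact (θ.localForm_trivialization hy (Y y)).symm

theorem smoothField_frameField (v : V) : SmoothField (θ.frameField v) := by
  intro x
  let t := trivializationAt E (TangentSpace I : M → Type _) x
  have hx : x ∈ t.baseSet := FiberBundle.mem_baseSet_trivializationAt' x
  have inverse : ContMDiffAt 𝓘(ℝ, E →L[ℝ] V) 𝓘(ℝ, V →L[ℝ] E) ∞ ContinuousLinearMap.inverse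
      (θ.localForm x x) := by
    rw [θ.localForm_eq hx]
    exact (contDiffAt_map_inverse _).contMDiffAt
  refine (Bundle.contMDiffAt_section (F := E) (E := (TangentSpace I : M → Type _)) x).2
    (((inverse.comp x (θ.contMDiffAt_localForm x)).clm_apply
      (contMDiffAt_const (c := v))).congr_of_eventuallyEq ?_)
  filter_upwards [t.open_baseSet.mem_nhds hx] with y hy
  rw [Function.comp_apply, θ.localForm_eq hy, ContinuousLinearMap.inverse_equiv]
  exact congrArg Prod.snd (t.apply_eq_prod_continuousLinearEquivAt ℝ y hy _)

theorem mlieBracket_frameField (v w : V) :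
    mlieBracket I (θ.frameField v) (θ.frameField w) = θ.frameField (br v w) := by
  funext x
  apply (θ x).injective
  rw [θ.form_mlieBracket _ _ x (θ.smoothField_frameField v) (θ.smoothField_frameField w)]
  simp [mvfderiv_const]

/-- The coefficients of the connection `D` at `x` in the framing `θ`. -/
def christoffel (D : Connection I M) (x : M) : V →ₗ[ℝ] V →ₗ[ℝ] V :=
  have differentiable v := (θ.smoothField_frameField v).mdifferentiableAt x
  LinearMap.mk₂ ℝ (fun v w ↦ θ x (D (θ.frameField w) x (θ.frameField v x)))
    (fun u v w ↦ by simp [frameField_add]) (fun c u v ↦ by simp [frameField_smul])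
    (fun u v w ↦ by
      rw [θ.frameField_add v w, D.isCovariantDerivativeOn.add (s := Set.univ) (differentiable v)
        (differentiable w)]
      simp)
    (fun c u v ↦ by
      rw [θ.frameField_smul c v, D.isCovariantDerivativeOn.smul_const (s := Set.univ) c
        (differentiable v)]
      simp)

theorem christoffel_apply (D : Connection I M) (x : M) (v w : V) :
    θ.christoffel D x v w = θ x (D (θ.frameField w) x (θ.frameField v x)) := rfl

theorem frameField_christoffel (D : Connection I M) (x : M) (v w : V) :
    θ.frameField (θ.christoffel D x v w) x = D (θ.frameField w) x (θ.frameField v x) :=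
  θ.frameField_form _

theorem form_torsion (D : Connection I M) (x : M) (u v : TangentSpace I x) :
    θ x (D.torsion x u v) = θ.christoffel D x (θ x u) (θ x v) - θ.christoffel D x (θ x v) (θ x u) -
      br (θ x u) (θ x v) := by
  have h := D.torsion_apply ((θ.smoothField_frameField (θ x u)).mdifferentiableAt x)
    ((θ.smoothField_frameField (θ x v)).mdifferentiableAt x)
  rw [θ.mlieBracket_frameField] at h
  simpa [christoffel_apply] using congrArg (θ x) h

theorem form_curvature_frameField {D : Connection I M} {Γ : V →ₗ[ℝ] V →ₗ[ℝ] V}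
    (hD : ∀ x, θ.christoffel D x = Γ) (u v w : V) (x : M) :
    θ x (curvature D (θ.frameField u) (θ.frameField v) (θ.frameField w) x) =
      Γ u (Γ v w) - Γ v (Γ u w) - Γ (br u v) w := by
  have derivative (v w : V) :
      (fun y ↦ D (θ.frameField w) y (θ.frameField v y)) = θ.frameField (Γ v w) :=
    funext fun y ↦ by rw [← θ.frameField_christoffel, hD]
  rw [curvature, derivative, derivative, mlieBracket_frameField]
  simp only [map_sub, ← christoffel_apply, hD]

variable [FiniteDimensional ℝ V]

/-- The connection with coefficients `Γ` in the framing `θ`. -/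
def frameConnection (Γ : V →ₗ[ℝ] V →ₗ[ℝ] V) : Connection I M where
  toFun Y x := ((θ x).symm : V →L[ℝ] TangentSpace I x) ∘L
    (mvfderiv I (fun y ↦ θ y (Y y)) x +
      Γ.toContinuousBilinearMap.flip (θ x (Y x)) ∘L (θ x : TangentSpace I x →L[ℝ] V))
  isCovariantDerivativeOnUniv :=
    { add := fun {Y Y' x} hY hY' _ ↦ by
        have h : (fun y ↦ θ y ((Y + Y') y)) = (fun y ↦ θ y (Y y)) + fun y ↦ θ y (Y' y) :=
          funext fun y ↦ map_add (θ y) _ _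
        rw [h, mvfderiv_add (θ.mdifferentiableAt_form hY) (θ.mdifferentiableAt_form hY')]
        ext1 u
        simp only [Pi.add_apply, map_add, ContinuousLinearMap.add_comp,
          ContinuousLinearMap.comp_add, add_apply, ContinuousLinearMap.comp_apply,
          ContinuousLinearEquiv.coe_coe, ContinuousLinearMap.flip_apply,
          LinearMap.toContinuousBilinearMap_apply]
        abel
      leibniz := fun {Y f x} hY hf _ ↦ by
        have h : (fun y ↦ θ y ((f • Y) y)) = f • (fun y ↦ θ y (Y y)) :=
          funext fun y ↦ map_smul (θ y) _ _
        rw [h, mvfderiv_smul hf (θ.mdifferentiableAt_form hY)]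
        ext1 u
        apply (θ x).injective
        simp only [Pi.smul_apply', map_smul, ContinuousLinearMap.smul_comp,
          ContinuousLinearMap.comp_add, ContinuousLinearMap.comp_smulₛₗ, Real.ringHom_apply,
          add_apply, smul_apply, ContinuousLinearMap.comp_apply, ContinuousLinearEquiv.coe_coe,
          ContinuousLinearMap.smulRight_apply, ContinuousLinearEquiv.symm_apply_apply,
          ContinuousLinearMap.flip_apply, LinearMap.toContinuousBilinearMap_apply, map_add,
          ContinuousLinearEquiv.apply_symm_apply, smul_add]
        abel }

variable {Γ : V →ₗ[ℝ] V →ₗ[ℝ] V}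

theorem form_frameConnection (Y : VField I M) (x : M) (u : TangentSpace I x) :
    θ x (θ.frameConnection Γ Y x u) =
      mvfderiv I (fun y ↦ θ y (Y y)) x u + Γ (θ x u) (θ x (Y x)) :=
  (θ x).apply_symm_apply _

theorem christoffel_frameConnection (x : M) : θ.christoffel (θ.frameConnection Γ) x = Γ := by
  ext v w
  simp [christoffel_apply, form_frameConnection, mvfderiv_const]

variable {X Y Z : VField I M}

theorem mvfderiv_form_frameConnection (hY : SmoothField Y) (hZ : SmoothField Z) (x : M)
    (u : TangentSpace I x) :
    mvfderiv I (fun y ↦ θ y (θ.frameConnection Γ Z y (Y y))) x u =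
      mvfderiv I (fun y ↦ mvfderiv I (fun y ↦ θ y (Z y)) y (Y y)) x u +
        (Γ (mvfderiv I (fun y ↦ θ y (Y y)) x u) (θ x (Z x)) +
          Γ (θ x (Y x)) (mvfderiv I (fun y ↦ θ y (Z y)) x u)) := by
  have hθY := θ.mdifferentiableAt_form (hY.mdifferentiableAt x)
  have hθZ := θ.mdifferentiableAt_form (hZ.mdifferentiableAt x)
  have second_order : MDifferentiableAt I 𝓘(ℝ, V)
      (fun y ↦ mvfderiv I (fun y ↦ θ y (Z y)) y (Y y)) x :=
    (hY.contMDiff_mvfderiv (θ.contMDiff_form hZ) x).mdifferentiableAt (by simp)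
  have product := mdifferentiableAt_bilinear Γ.toContinuousBilinearMap hθY hθZ
  have leibniz := mvfderiv_bilinear Γ.toContinuousBilinearMap hθY hθZ u
  simp only [LinearMap.toContinuousBilinearMap_apply] at product leibniz
  simp only [form_frameConnection]
  rw [mvfderiv_fun_add second_order product, add_apply, leibniz]

theorem form_curvature_frameConnection (hX : SmoothField X) (hY : SmoothField Y)
    (hZ : SmoothField Z) (x : M) :
    θ x (curvature (θ.frameConnection Γ) X Y Z x) =
      Γ (θ x (X x)) (Γ (θ x (Y x)) (θ x (Z x))) - Γ (θ x (Y x)) (Γ (θ x (X x)) (θ x (Z x))) -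
        Γ (br (θ x (X x)) (θ x (Y x))) (θ x (Z x)) := by
  rw [curvature, map_sub, map_sub]
  simp only [θ.form_frameConnection _ x]
  rw [θ.mvfderiv_form_frameConnection hY hZ, θ.mvfderiv_form_frameConnection hX hZ,
    mvfderiv_mlieBracket hX hY (θ.contMDiff_form hZ), θ.form_mlieBracket X Y x hX hY]
  simp only [map_add, map_sub, LinearMap.add_apply, LinearMap.sub_apply]
  abel

/-- The bilinear form `B` in the framing `θ`. -/
def frameForm (B : V →ₗ[ℝ] V →ₗ[ℝ] ℝ) (x : M) :
    TangentSpace I x →L[ℝ] TangentSpace I x →L[ℝ] ℝ :=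
  (ContinuousLinearMap.precomp ℝ (θ x : TangentSpace I x →L[ℝ] V)) ∘L
    B.toContinuousBilinearMap ∘L (θ x : TangentSpace I x →L[ℝ] V)

theorem contMDiff_frameForm (B : V →ₗ[ℝ] V →ₗ[ℝ] ℝ) :
    ContMDiff I (I.prod 𝓘(ℝ, E →L[ℝ] E →L[ℝ] ℝ)) ∞ (fun x : M ↦
      Bundle.TotalSpace.mk' (E →L[ℝ] E →L[ℝ] ℝ)
        (E := fun x ↦ TangentSpace I x →L[ℝ] TangentSpace I x →L[ℝ] ℝ) x (θ.frameForm B x)) := by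
  intro x
  rw [contMDiffAt_hom_bundle]
  refine ⟨contMDiffAt_id, contMDiffAt_clm_of_apply fun v ↦ contMDiffAt_clm_of_apply fun w ↦ ?_⟩
  have constant (v : E) : ContMDiffAt I 𝓘(ℝ, E) ∞ (fun _ : M ↦ v) x := contMDiffAt_const
  have smooth v := (θ.contMDiffAt_localForm x).clm_apply (constant v)
  refine (contMDiffAt_bilinear B.toContinuousBilinearMap (smooth v)
    (smooth w)).congr_of_eventuallyEq ?_
  filter_upwards [(trivializationAt E (TangentSpace I : M → Type _) x).open_baseSet.mem_nhds
    (FiberBundle.mem_baseSet_trivializationAt' x)] with y hy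
  rw [inCoordinates_apply_eq₂ hy hy (Set.mem_univ _)]
  simp [localForm, frameForm, Bundle.Trivialization.symmL_apply _ hy]

/-- The metric on `M` which is the inner product `B` in the framing `θ`. -/
def frameMetric {B : V →ₗ[ℝ] V →ₗ[ℝ] ℝ} (hB : IsInnerProduct B) : SmoothMetric I M where
  inner := θ.frameForm B
  symm x u v := hB.symm _ _
  pos x u hu := hB.pos _ fun h ↦ hu ((θ x).map_eq_zero_iff.1 h)
  isVonNBounded x := by
    refine (hB.isVonNBounded.image ((θ x).symm : V →L[ℝ] TangentSpace I x)).subset ?_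
    exact fun u hu ↦ ⟨θ x u, hu, (θ x).symm_apply_apply u⟩
  contMDiff := θ.contMDiff_frameForm B

theorem inner_frameMetric {B : V →ₗ[ℝ] V →ₗ[ℝ] ℝ} (hB : IsInnerProduct B) (x : M)
    (u v : TangentSpace I x) : (θ.frameMetric hB).inner x u v = B (θ x u) (θ x v) := rfl

end LieFraming

end Framing

section Reduction

open Module

variable {E : Type*} [NormedAddCommGroup E] [NormedSpace ℝ E]
  {H : Type*} [TopologicalSpace H] {I : ModelWithCorners ℝ E H}
  {M : Type*} [TopologicalSpace M] [ChartedSpace H M] [IsManifold I ∞ M]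
  {V : Type*} [NormedAddCommGroup V] [NormedSpace ℝ V] {br : V →ₗ[ℝ] V →ₗ[ℝ] V}

namespace LieFraming

variable (θ : LieFraming I M br)

/-- The metric `g` is given by the constant bilinear form `B` in the framing `θ`. -/
def IsMetricForm (g : SmoothMetric I M) (B : V →ₗ[ℝ] V →ₗ[ℝ] ℝ) : Prop :=
  ∀ (x : M) (u v : TangentSpace I x), g.inner x u v = B (θ x u) (θ x v)

variable {θ} {g : SmoothMetric I M} {B : V →ₗ[ℝ] V →ₗ[ℝ] ℝ} {J : EndField I M} {J₀ : V →ₗ[ℝ] V}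

theorem finrank_eq (θ : LieFraming I M br) [Nonempty M] : finrank ℝ V = finrank ℝ E :=
  (θ (Classical.arbitrary M)).toLinearEquiv.finrank_eq.symm

theorem IsMetricForm.isHermitianForm [Nonempty M] (hg : θ.IsMetricForm g B)
    (hJ : ∀ x u, θ x (J x u) = J₀ (θ x u)) (hJ₀ : ∀ v, J₀ (J₀ v) = -v)
    (h : IsHermitian J g) : IsHermitianForm B J₀ := by
  let x := Classical.arbitrary M
  have inner_frameField v w : g.inner x (θ.frameField v x) (θ.frameField w x) = B v w := by
    rw [hg, form_frameField, form_frameField]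
  refine ⟨⟨fun v w ↦ ?_, fun v hv ↦ ?_⟩, fun v w ↦ ?_⟩
  · rw [← inner_frameField, g.symm, inner_frameField]
  · rw [← inner_frameField]
    exact g.pos x _ fun h0 ↦ hv (by rw [← θ.form_frameField v x, h0, map_zero])
  · have := h x (θ.frameField v x) (θ.frameField (J₀ w) x)
    simp only [hg x, hJ, form_frameField, hJ₀, map_neg] at this
    linarith

theorem isLeftInvariant_iff [Group M]
    (hθ : ∀ (h x : M) (u : TangentSpace I x),
      θ (h * x) (mfderiv I I (fun y ↦ h * y) x u) = θ x u) :
    IsLeftInvariant g ↔ ∃ B, θ.IsMetricForm g B := by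
  constructor
  · intro hg
    refine ⟨(g.inner 1).toLinearMap₁₂.compl₁₂ (θ 1).symm.toLinearMap (θ 1).symm.toLinearMap,
      fun x u v ↦ ?_⟩
    have inner_eq_of_form_eq {y : M} (hy : y = x) {u' v' : TangentSpace I y}
        (hu : θ y u' = θ x u) (hv : θ y v' = θ x v) : g.inner y u' v' = g.inner x u v := by
      subst hy
      rw [(θ y).injective hu, (θ y).injective hv]
    refine ((hg x 1 _ _).symm.trans (inner_eq_of_form_eq (mul_one x) ?_ ?_)).symm
    · exact (hθ x 1 _).trans ((θ 1).apply_symm_apply _)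
    · exact (hθ x 1 _).trans ((θ 1).apply_symm_apply _)
  · rintro ⟨B, hg⟩ h x u v
    rw [hg, hg, hθ, hθ]

variable [FiniteDimensional ℝ E]

theorem IsMetricForm.isAlgBismut (hg : θ.IsMetricForm g B) (hJ : ∀ x u, θ x (J x u) = J₀ (θ x u))
    {D : Connection I M} (hD : IsBismut J g D) (x : M) :
    IsAlgBismut B J₀ br (θ.christoffel D x) where
  metric u v w := by
    have h := hD.metric _ _ (θ.smoothField_frameField v) (θ.smoothField_frameField w) x
      (θ.frameField u x)
    simp only [hg _, form_frameField, mvfderiv_const, ← christoffel_apply] at h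
    exact h.symm
  complex u v := by
    have h := hD.complex _ (θ.smoothField_frameField v) x (θ.frameField u x)
    have J_frameField : (fun y ↦ J y (θ.frameField v y)) = θ.frameField (J₀ v) := by
      funext y
      rw [← θ.frameField_form (J y _), hJ, form_frameField]
    rw [J_frameField] at h
    rw [christoffel_apply, h, hJ, christoffel_apply]
  skew u v w := by
    have h := hD.skew x (θ.frameField u x) (θ.frameField v x) (θ.frameField w x)
    simpa only [hg x, form_torsion, form_frameField] using h

variable [FiniteDimensional ℝ V]

-- The coefficients of the Bismut connection are constant because they are determined by `B`,
-- `J₀` and `br`.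
theorem IsMetricForm.exists_isAlgBismut [Nonempty M] (hg : θ.IsMetricForm g B)
    (hJ : ∀ x u, θ x (J x u) = J₀ (θ x u)) (hJ₀ : ∀ v, J₀ (J₀ v) = -v) (h : IsCYT J g) :
    ∃ Γ, IsAlgBismut B J₀ br Γ ∧ ∀ u v, LinearMap.trace ℝ V (J₀ ∘ₗ Γ (br u v)) = 0 := by
  obtain ⟨hherm, D, hD, hRicci⟩ := h
  let x := Classical.arbitrary M
  have hB := hg.isHermitianForm hJ hJ₀ hherm
  have bismut := hg.isAlgBismut hJ hD
  have constant y : θ.christoffel D y = θ.christoffel D x := (bismut y).unique hB hJ₀ (bismut x)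
  obtain ⟨e, he⟩ : ∃ e : Basis (Fin (finrank ℝ E)) ℝ V, IsOrthonormal B e :=
    θ.finrank_eq ▸ hB.exists_basis_isOrthonormal
  refine ⟨θ.christoffel D x, bismut x, fun u v ↦ ?_⟩
  rw [← (bismut x).sum_curvature hB he]
  simpa only [hg x, hJ, θ.form_curvature_frameField constant, form_frameField] using
    hRicci _ _ (θ.smoothField_frameField u) (θ.smoothField_frameField v) x
      (fun k ↦ θ.frameField (e k)) (fun k ↦ θ.smoothField_frameField (e k))
      (by simpa only [hg x, form_frameField, IsOrthonormal] using he)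

variable {Γ : V →ₗ[ℝ] V →ₗ[ℝ] V}

theorem isBismut_frameConnection (hB : IsInnerProduct B) (hJ : ∀ x u, θ x (J x u) = J₀ (θ x u))
    (h : IsAlgBismut B J₀ br Γ) : IsBismut J (θ.frameMetric hB) (θ.frameConnection Γ) where
  metric Y Z hY hZ x u := by
    have leibniz := mvfderiv_bilinear B.toContinuousBilinearMap
      (θ.mdifferentiableAt_form (hY.mdifferentiableAt x))
      (θ.mdifferentiableAt_form (hZ.mdifferentiableAt x)) u
    simp only [LinearMap.toContinuousBilinearMap_apply] at leibniz
    simp only [inner_frameMetric, form_frameConnection, map_add, LinearMap.add_apply]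
    linarith [h.metric (θ x u) (θ x (Y x)) (θ x (Z x))]
  complex Y hY x u := by
    apply (θ x).injective
    have derivative := mvfderiv_clm_comp J₀.toContinuousLinearMap
      (θ.mdifferentiableAt_form (hY.mdifferentiableAt x)) u
    simp only [LinearMap.coe_toContinuousLinearMap'] at derivative
    simp only [hJ, form_frameConnection, derivative, h.complex, map_add]
  skew x u v w := by
    simp only [inner_frameMetric, form_torsion, christoffel_frameConnection]
    exact h.skew _ _ _

theorem isCYT_frameMetric [Nonempty M] (hB : IsHermitianForm B J₀)
    (hJ : ∀ x u, θ x (J x u) = J₀ (θ x u)) (hJ₀ : ∀ v, J₀ (J₀ v) = -v)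
    (h : IsAlgBismut B J₀ br Γ) (htr : ∀ u v, LinearMap.trace ℝ V (J₀ ∘ₗ Γ (br u v)) = 0) :
    IsCYT J (θ.frameMetric hB.toIsInnerProduct) := by
  refine ⟨fun x u v ↦ ?_, θ.frameConnection Γ, isBismut_frameConnection _ hJ h, ?_⟩
  · rw [inner_frameMetric, hJ, hJ, hB.apply_apply hJ₀, inner_frameMetric]
  · intro X Y hX hY x E hE orthonormal
    obtain ⟨e, he⟩ := IsOrthonormal.exists_basis_eq (B := B) (v := fun k ↦ θ x (E k x)) orthonormal
      (by rw [Fintype.card_fin, θ.finrank_eq])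
    have form_E k : θ x (E k x) = e k := (congrFun he k).symm
    simp only [inner_frameMetric, θ.form_curvature_frameConnection hX hY (hE _), hJ, form_E]
    rw [h.sum_curvature hB (he ▸ orthonormal), htr]

theorem exists_isCYT_iff (θ : LieFraming I M br) [Nonempty M]
    (hJ : ∀ x u, θ x (J x u) = J₀ (θ x u)) (hJ₀ : ∀ v, J₀ (J₀ v) = -v) :
    (∃ g : SmoothMetric I M, (∃ B, θ.IsMetricForm g B) ∧ IsCYT J g) ↔
      ∃ B Γ, IsHermitianForm B J₀ ∧ IsAlgBismut B J₀ br Γ ∧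
        ∀ u v, LinearMap.trace ℝ V (J₀ ∘ₗ Γ (br u v)) = 0 := by
  constructor
  · rintro ⟨g, ⟨B, hg⟩, h⟩
    obtain ⟨Γ, hΓ⟩ := hg.exists_isAlgBismut hJ hJ₀ h
    exact ⟨B, Γ, hg.isHermitianForm hJ hJ₀ h.1, hΓ⟩
  · rintro ⟨B, Γ, hB, hΓ, htr⟩
    exact ⟨θ.frameMetric hB.toIsInnerProduct, ⟨B, θ.inner_frameMetric _⟩,
      isCYT_frameMetric hB hJ hJ₀ hΓ htr⟩

end LieFraming

end Reduction

section MaurerCartan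

open VectorField
open scoped Matrix

/-- The Lie algebra of `SU(2) × SU(2)`, in coordinates with respect to the coframe
`(α₁, e₁^-, e₁^+, α₂, e₂^-, e₂^+)`. -/
abbrev LieAlg : Type := Fin 2 → Fin 3 → ℝ

/-- The bracket of the Lie algebra of `SU(2) × SU(2)`. The order of the factors in the cross product
is reversed because the coframe is a negative multiple of `q⁻¹ dq`. -/
def lieBr : LieAlg →ₗ[ℝ] LieAlg →ₗ[ℝ] LieAlg :=
  LinearMap.mk₂ ℝ (fun v w i ↦ w i ⨯₃ v i) (fun _ _ _ ↦ funext fun _ ↦ map_add ..)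
    (fun _ _ _ ↦ funext fun _ ↦ (crossProduct _).map_smul _ _)
    (fun _ _ _ ↦ funext fun _ ↦ LinearMap.map_add₂ ..)
    (fun _ _ _ ↦ funext fun _ ↦ LinearMap.map_smul₂ ..)

theorem lieBr_apply (v w : LieAlg) (i : Fin 2) : lieBr v w i = w i ⨯₃ v i := rfl

/-- The imaginary quaternion whose `i, j, k`-components are `-1/2` times the given numbers; it
recovers `q⁻¹ dq` from the values of `α, e^-, e^+`. -/
def toQuaternion : (Fin 3 → ℝ) →L[ℝ] ℍ[ℝ] :=
  LinearMap.toContinuousLinearMap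
    { toFun v := ⟨0, -v 0 / 2, -v 1 / 2, -v 2 / 2⟩
      map_add' v w :=
        have neg_add_div_two (j : Fin 3) : -(v j + w j) / 2 = -v j / 2 + -w j / 2 := by ring
        Quaternion.ext _ _ (add_zero 0).symm (neg_add_div_two 0) (neg_add_div_two 1)
          (neg_add_div_two 2)
      map_smul' c v :=
        have smul (j : Fin 3) : -(c * v j) / 2 = c * (-v j / 2) := by ring
        Quaternion.ext _ _ (mul_zero c).symm (smul 0) (smul 1) (smul 2) }

@[simp] theorem toQuaternion_re (v : Fin 3 → ℝ) : (toQuaternion v).re = 0 := rfl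

@[simp] theorem toQuaternion_imI (v : Fin 3 → ℝ) : (toQuaternion v).imI = -v 0 / 2 := rfl

@[simp] theorem toQuaternion_imJ (v : Fin 3 → ℝ) : (toQuaternion v).imJ = -v 1 / 2 := rfl

@[simp] theorem toQuaternion_imK (v : Fin 3 → ℝ) : (toQuaternion v).imK = -v 2 / 2 := rfl

/-- The inverse of `toQuaternion` on imaginary quaternions; it recovers the values of `α, e^-, e^+`
from `q⁻¹ dq`. -/
def ofQuaternion : ℍ[ℝ] →L[ℝ] (Fin 3 → ℝ) :=
  LinearMap.toContinuousLinearMap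
    { toFun q := ![-2 * q.imI, -2 * q.imJ, -2 * q.imK]
      map_add' p q := by ext j; fin_cases j <;> simp [mul_add]
      map_smul' c q := by ext j; fin_cases j <;> simp <;> ring }

theorem ofQuaternion_apply (q : ℍ[ℝ]) :
    ofQuaternion q = ![-2 * q.imI, -2 * q.imJ, -2 * q.imK] := rfl

theorem toQuaternion_ofQuaternion {q : ℍ[ℝ]} (hq : q.re = 0) :
    toQuaternion (ofQuaternion q) = q := by
  ext <;> simp [ofQuaternion_apply, hq]

theorem toQuaternion_injective : Function.Injective toQuaternion :=
  Function.LeftInverse.injective (g := ofQuaternion) fun v ↦ by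
    ext j
    fin_cases j <;> simp [ofQuaternion_apply] <;> ring

theorem toQuaternion_cross (v w : Fin 3 → ℝ) :
    toQuaternion (w ⨯₃ v) = toQuaternion v * toQuaternion w - toQuaternion w * toQuaternion v := by
  ext <;> simp [cross_apply] <;> ring

theorem contMDiff_factor (i : Fin 2) :
    ContMDiff I₆ 𝓘(ℝ, ℍ[ℝ]) ∞ (fun y : G ↦ (factor i y : ℍ[ℝ])) := by
  fin_cases i
  · exact contMDiff_coe_sphere.comp contMDiff_fst
  · exact contMDiff_coe_sphere.comp contMDiff_snd

theorem mdifferentiableAt_factor (i : Fin 2) (x : G) :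
    MDifferentiableAt I₆ 𝓘(ℝ, ℍ[ℝ]) (fun y : G ↦ (factor i y : ℍ[ℝ])) x :=
  (contMDiff_factor i x).mdifferentiableAt (by simp)

theorem self_mul_star_factor (i : Fin 2) (x : G) :
    (factor i x : ℍ[ℝ]) * star (factor i x : ℍ[ℝ]) = 1 := by
  rw [Quaternion.self_mul_star, Quaternion.normSq_eq_norm_mul_self, norm_eq_of_mem_sphere, mul_one,
    Quaternion.coe_one]

theorem factor_mul (i : Fin 2) (x y : G) :
    (factor i (x * y) : ℍ[ℝ]) = (factor i x : ℍ[ℝ]) * factor i y := by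
  fin_cases i <;> rfl

instance finiteDimensional_tangentSpace (x : G) : FiniteDimensional ℝ (TangentSpace I₆ x) :=
  inferInstanceAs (FiniteDimensional ℝ (EuclideanSpace ℝ (Fin 3) × EuclideanSpace ℝ (Fin 3)))

instance t2Space_tangentSpace (x : G) : T2Space (TangentSpace I₆ x) :=
  inferInstanceAs (T2Space (EuclideanSpace ℝ (Fin 3) × EuclideanSpace ℝ (Fin 3)))

theorem coframe_injective (x : G) : Function.Injective (coframe x) := fun _ _ h ↦
  eq_of_forms_eq (fun i ↦ congrFun (congrFun h i) 0) (fun i ↦ congrFun (congrFun h i) 1)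
    (fun i ↦ congrFun (congrFun h i) 2)

theorem coframe_surjective (x : G) : Function.Surjective (coframe x) := by
  have finrank_eq : Module.finrank ℝ (TangentSpace I₆ x) = Module.finrank ℝ LieAlg := by
    change Module.finrank ℝ (EuclideanSpace ℝ (Fin 3) × EuclideanSpace ℝ (Fin 3)) = _
    rw [Module.finrank_pi_fintype]
    simp
  exact (LinearMap.injective_iff_surjective_of_finrank_eq_finrank finrank_eq).1
    (coframe_injective x)

/-- The coframe at a point, as an identification of the tangent space with the Lie algebra. -/
def coframeEquiv (x : G) : TangentSpace I₆ x ≃L[ℝ] LieAlg :=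
  (LinearEquiv.ofBijective (coframe x)
    ⟨coframe_injective x, coframe_surjective x⟩).toContinuousLinearEquiv

theorem coframeEquiv_apply (x : G) (u : TangentSpace I₆ x) (i : Fin 2) :
    coframeEquiv x u i = ofQuaternion (maurerCartan i x u) := rfl

theorem mvfderiv_factor_eq (i : Fin 2) (x : G) (u : TangentSpace I₆ x) :
    mvfderiv I₆ (fun y : G ↦ (factor i y : ℍ[ℝ])) x u =
      (factor i x : ℍ[ℝ]) * toQuaternion (coframeEquiv x u i) := by
  rw [coframeEquiv_apply, toQuaternion_ofQuaternion (maurerCartan_re i x u), maurerCartan,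
    ← mul_assoc, self_mul_star_factor, one_mul]

theorem coframeEquiv_eq_of_mvfderiv_factor {x : G} {u : TangentSpace I₆ x} {v : LieAlg}
    (h : ∀ i, mvfderiv I₆ (fun y : G ↦ (factor i y : ℍ[ℝ])) x u =
      (factor i x : ℍ[ℝ]) * toQuaternion (v i)) : coframeEquiv x u = v :=
  funext fun i ↦ toQuaternion_injective <|
    mul_left_cancel₀ (left_ne_zero_of_mul_eq_one (self_mul_star_factor i x)) <|
      (mvfderiv_factor_eq i x u).symm.trans (h i)

/-- The bilinear map `(p, q) ↦ p̄ q` on the quaternions. -/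
def starMul : ℍ[ℝ] →L[ℝ] ℍ[ℝ] →L[ℝ] ℍ[ℝ] :=
  ContinuousLinearMap.mul ℝ ℍ[ℝ] ∘L LinearMap.toContinuousLinearMap
    { toFun := star
      map_add' := star_add
      map_smul' := Quaternion.star_smul }

theorem contMDiffAt_coframeEquiv (Y : VField I₆ G) (x : G)
    (hY : ContMDiffAt I₆ I₆.tangent ∞ (fun y ↦ (⟨y, Y y⟩ : TangentBundle I₆ G)) x) :
    ContMDiffAt I₆ 𝓘(ℝ, LieAlg) ∞ (fun y ↦ coframeEquiv y (Y y)) x :=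
  contMDiffAt_pi_space.2 fun i ↦ ofQuaternion.contMDiff.contMDiffAt.comp x <|
    contMDiffAt_bilinear starMul (contMDiff_factor i x)
      (contMDiffAt_mvfderiv_apply (contMDiff_factor i) hY)

theorem mvfderiv_mvfderiv_factor {X Y : VField I₆ G} (hY : SmoothField Y) (i : Fin 2) (x : G) :
    mvfderiv I₆ (fun y ↦ mvfderiv I₆ (fun y : G ↦ (factor i y : ℍ[ℝ])) y (Y y)) x (X x) =
      (factor i x : ℍ[ℝ]) * (toQuaternion (coframeEquiv x (X x) i) *
        toQuaternion (coframeEquiv x (Y x) i) +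
          toQuaternion (mvfderiv I₆ (fun y ↦ coframeEquiv y (Y y)) x (X x) i)) := by
  let L : LieAlg →L[ℝ] ℍ[ℝ] := toQuaternion ∘L ContinuousLinearMap.proj i
  have form : MDifferentiableAt I₆ 𝓘(ℝ, LieAlg) (fun y ↦ coframeEquiv y (Y y)) x :=
    (contMDiffAt_coframeEquiv Y x (hY x)).mdifferentiableAt (by simp)
  have leibniz := mvfderiv_bilinear (ContinuousLinearMap.mul ℝ ℍ[ℝ]) (mdifferentiableAt_factor i x)
    (L.differentiableAt.mdifferentiableAt.comp x form) (X x)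
  simp only [Function.comp_def, mvfderiv_clm_comp L form, ContinuousLinearMap.mul_apply'] at leibniz
  simp only [mvfderiv_factor_eq i _ (Y _)]
  rw [mul_add, ← mul_assoc, ← mvfderiv_factor_eq]
  exact leibniz

theorem coframeEquiv_mlieBracket (X Y : VField I₆ G) (x : G) (hX : SmoothField X)
    (hY : SmoothField Y) : coframeEquiv x (mlieBracket I₆ X Y x) =
      mvfderiv I₆ (fun y ↦ coframeEquiv y (Y y)) x (X x) -
        mvfderiv I₆ (fun y ↦ coframeEquiv y (X y)) x (Y x) +
          lieBr (coframeEquiv x (X x)) (coframeEquiv x (Y x)) := by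
  refine coframeEquiv_eq_of_mvfderiv_factor fun i ↦ ?_
  rw [mvfderiv_mlieBracket hX hY (contMDiff_factor i), mvfderiv_mvfderiv_factor hY,
    mvfderiv_mvfderiv_factor hX, Pi.add_apply, Pi.sub_apply, map_add, map_sub, lieBr_apply,
    toQuaternion_cross]
  noncomm_ring

/-- The framing of `SU(2) × SU(2)` by the coframe; `form_mlieBracket` is the Maurer-Cartan
equation. -/
def maurerCartanFraming : LieFraming I₆ G lieBr where
  form := coframeEquiv
  contMDiffAt_form := contMDiffAt_coframeEquiv
  form_mlieBracket := coframeEquiv_mlieBracket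

theorem coframeEquiv_mul (h x : G) (u : TangentSpace I₆ x) :
    coframeEquiv (h * x) (mfderiv I₆ I₆ (fun y ↦ h * y) x u) = coframeEquiv x u := by
  refine coframeEquiv_eq_of_mvfderiv_factor fun i ↦ ?_
  have translation : MDifferentiableAt I₆ I₆ (fun y : G ↦ h * y) x :=
    (contMDiff_mul_left (I := I₆) (n := ω) (a := h)).mdifferentiableAt (by simp)
  have linear := mvfderiv_clm_comp (ContinuousLinearMap.mul ℝ ℍ[ℝ] (factor i h))
    (mdifferentiableAt_factor i x) u
  simp only [ContinuousLinearMap.mul_apply', ← factor_mul] at linear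
  calc mvfderiv I₆ (fun y : G ↦ (factor i y : ℍ[ℝ])) (h * x) (mfderiv I₆ I₆ (fun y ↦ h * y) x u)
      = mvfderiv I₆ (fun y : G ↦ (factor i (h * y) : ℍ[ℝ])) x u :=
        (mfderiv_comp_apply x (mdifferentiableAt_factor i (h * x)) translation u).symm
    _ = (factor i (h * x) : ℍ[ℝ]) * toQuaternion (coframeEquiv x u i) := by
        rw [linear, mvfderiv_factor_eq, factor_mul, mul_assoc]

theorem isLeftInvariant_iff_isMetricForm {g : SmoothMetric I₆ G} :
    IsLeftInvariant g ↔ ∃ B, maurerCartanFraming.IsMetricForm g B :=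
  LieFraming.isLeftInvariant_iff coframeEquiv_mul

end MaurerCartan

section ComplexStructure

open Module

/-- The endomorphism of the Lie algebra that represents the structures `IsStructure a b`. -/
def stdJ (a b : ℝ) : LieAlg →ₗ[ℝ] LieAlg where
  toFun v := ![![a * v 0 0 + b * v 1 0, -v 0 2, v 0 1],
    ![-(a ^ 2 + 1) / b * v 0 0 - a * v 1 0, -v 1 2, v 1 1]]
  map_add' v w := by
    ext i j
    fin_cases i <;> fin_cases j <;> simp <;> ring
  map_smul' c v := by
    ext i j
    fin_cases i <;> fin_cases j <;> simp <;> ring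

theorem stdJ_apply (a b : ℝ) (v : LieAlg) : stdJ a b v =
    ![![a * v 0 0 + b * v 1 0, -v 0 2, v 0 1],
      ![-(a ^ 2 + 1) / b * v 0 0 - a * v 1 0, -v 1 2, v 1 1]] := rfl

theorem stdJ_stdJ (a : ℝ) {b : ℝ} (hb : b ≠ 0) (v : LieAlg) : stdJ a b (stdJ a b v) = -v := by
  ext i j
  fin_cases i <;> fin_cases j <;> simp [stdJ_apply] <;> field_simp <;> ring

theorem IsStructure.coframeEquiv_apply {a b : ℝ} {J : EndField I₆ G} (hJ : IsStructure a b J)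
    (x : G) (u : TangentSpace I₆ x) : coframeEquiv x (J x u) = stdJ a b (coframeEquiv x u) := by
  ext i j
  fin_cases i <;> fin_cases j
  · exact hJ.alpha₁ x u
  · exact hJ.eMinus 0 x u
  · exact hJ.ePlus 0 x u
  · exact hJ.alpha₂ x u
  · exact hJ.eMinus 1 x u
  · exact hJ.ePlus 1 x u

theorem trace_lieAlg (T : LieAlg →ₗ[ℝ] LieAlg) :
    LinearMap.trace ℝ LieAlg T = ∑ i, ∑ j, T (Pi.single i (Pi.single j 1)) i j := by
  rw [LinearMap.trace_eq_matrix_trace ℝ (Pi.basis fun _ : Fin 2 ↦ Pi.basisFun ℝ (Fin 3)),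
    Matrix.trace, Fintype.sum_sigma]
  simp [LinearMap.toMatrix_apply, Pi.basis_apply]

theorem lieBr_eq_neg (u v : LieAlg) : lieBr u v = -lieBr v u :=
  funext fun i ↦ (cross_anticomm (u i) (v i)).symm

theorem trace_lieBr (u : LieAlg) : LinearMap.trace ℝ LieAlg (lieBr u) = 0 := by
  simp [trace_lieAlg, Fin.sum_univ_three, lieBr_apply, cross_apply]

theorem trace_stdJ_comp_lieBr (a b : ℝ) (u : LieAlg) :
    LinearMap.trace ℝ LieAlg (stdJ a b ∘ₗ lieBr u) = 2 * (u 0 0 + u 1 0) := by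
  simp [trace_lieAlg, Fin.sum_univ_three, lieBr_apply, cross_apply, stdJ_apply]
  ring

theorem eq_zero_of_lieBr {φ : Dual ℝ LieAlg} (h : ∀ u v, φ (lieBr u v) = 0) : φ = 0 := by
  refine LinearMap.ext fun v ↦ ?_
  have decomposition : v =
      lieBr (fun _ ↦ ![0, 0, 1]) (fun i ↦ ![0, v i 0, 0]) +
        lieBr (fun _ ↦ ![1, 0, 0]) (fun i ↦ ![0, 0, v i 1]) +
          lieBr (fun _ ↦ ![0, 1, 0]) (fun i ↦ ![v i 2, 0, 0]) := by
    ext i j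
    fin_cases j <;> simp [lieBr_apply, cross_apply]
  rw [decomposition, map_add, map_add, h, h, h, add_zero, add_zero, LinearMap.zero_apply]

end ComplexStructure

section Inequalities

open Module

/-- The functional on the Lie algebra with values the given coordinate: for `j = 0, 1, 2` it is
`α, e^-, e^+` of the factor `i`. -/
def coord (i : Fin 2) (j : Fin 3) : Dual ℝ LieAlg := LinearMap.proj j ∘ₗ LinearMap.proj i

@[simp] theorem coord_apply (i : Fin 2) (j : Fin 3) (v : LieAlg) : coord i j v = v i j := rfl

theorem coord_ne_zero (i : Fin 2) (j : Fin 3) : coord i j ≠ 0 := fun h ↦ by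
  simpa using LinearMap.congr_fun h (Pi.single i (Pi.single j 1))

theorem coord_comp_stdJ (a b : ℝ) : coord 0 0 ∘ₗ stdJ a b = a • coord 0 0 + b • coord 1 0 := rfl

variable {a b : ℝ} {B : LieAlg →ₗ[ℝ] LieAlg →ₗ[ℝ] ℝ} {Γ : LieAlg →ₗ[ℝ] LieAlg →ₗ[ℝ] LieAlg}
  {ι : Type*} [Fintype ι]

theorem coord_sum_lieBr_stdJ (e : ι → LieAlg) (i : Fin 2) :
    coord i 0 (∑ k, lieBr (e k) (stdJ a b (e k))) =
      -(cometric e (coord i 1) (coord i 1) + cometric e (coord i 2) (coord i 2)) := by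
  rw [map_sum, cometric_apply, cometric_apply, ← Finset.sum_add_distrib, ← Finset.sum_neg_distrib]
  refine Finset.sum_congr rfl fun k _ ↦ ?_
  fin_cases i <;> simp [lieBr_apply, cross_apply, stdJ_apply] <;> ring

variable [DecidableEq ι] {e : Basis ι ℝ LieAlg}

theorem IsAlgBismut.apply_sum_lieBr (hB : IsHermitianForm B (stdJ a b)) (he : IsOrthonormal B e)
    (hΓ : IsAlgBismut B (stdJ a b) lieBr Γ)
    (htrace : ∀ u v, LinearMap.trace ℝ LieAlg (stdJ a b ∘ₗ Γ (lieBr u v)) = 0) :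
    B (∑ k, lieBr (e k) (stdJ a b (e k))) = (-2 : ℝ) • (coord 0 0 + coord 1 0) := by
  have trace_eq_zero : LinearMap.trace ℝ LieAlg ∘ₗ (stdJ a b).compRight ℝ ∘ₗ Γ = 0 :=
    eq_zero_of_lieBr htrace
  refine LinearMap.ext fun u ↦ ?_
  have trace_comp := hΓ.trace_comp hB he lieBr_eq_neg u
  rw [show LinearMap.trace ℝ LieAlg (stdJ a b ∘ₗ Γ u) = 0 from LinearMap.congr_fun trace_eq_zero u,
    trace_stdJ_comp_lieBr, trace_lieBr] at trace_comp
  simp only [map_sum, LinearMap.sum_apply, LinearMap.smul_apply, LinearMap.add_apply, coord_apply,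
    smul_eq_mul]
  linarith

theorem IsAlgBismut.cometric_coord_pos (hB : IsHermitianForm B (stdJ a b)) (he : IsOrthonormal B e)
    (hΓ : IsAlgBismut B (stdJ a b) lieBr Γ)
    (htrace : ∀ u v, LinearMap.trace ℝ LieAlg (stdJ a b ∘ₗ Γ (lieBr u v)) = 0) (i : Fin 2) :
    0 < cometric e (coord i 0) (coord 0 0 + coord 1 0) := by
  have eval := he.cometric_apply_left (coord i 0) (∑ k, lieBr (e k) (stdJ a b (e k)))
  rw [hΓ.apply_sum_lieBr hB he htrace, coord_sum_lieBr_stdJ, map_smul, smul_eq_mul] at eval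
  linarith [cometric_self_pos e (coord_ne_zero i 1), cometric_self_pos e (coord_ne_zero i 2)]

theorem IsHermitianForm.cometric_coord (hb : b ≠ 0) (hB : IsHermitianForm B (stdJ a b))
    (he : IsOrthonormal B e) :
    a * cometric e (coord 0 0) (coord 0 0) + b * cometric e (coord 0 0) (coord 1 0) = 0 ∧
      b ^ 2 * cometric e (coord 1 0) (coord 1 0) =
        (a ^ 2 + 1) * cometric e (coord 0 0) (coord 0 0) := by
  have skew := he.cometric_comp_complex hB (coord 0 0)
  have apart := skew (coord 0 0)
  have norm := skew (coord 0 0 ∘ₗ stdJ a b)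
  have square : (coord 0 0 ∘ₗ stdJ a b) ∘ₗ stdJ a b = -coord 0 0 :=
    LinearMap.ext fun v ↦ congrFun (congrFun (stdJ_stdJ a hb v) 0) 0
  rw [square] at norm
  simp only [coord_comp_stdJ, map_add, map_smul, map_neg, LinearMap.add_apply, LinearMap.smul_apply,
    smul_eq_mul, cometric_comm e (coord 1 0) (coord 0 0)] at apart norm
  constructor
  · linarith
  · linear_combination norm - a * apart

theorem IsAlgBismut.inequalities (hb : b ≠ 0) (hB : IsHermitianForm B (stdJ a b))
    (hΓ : IsAlgBismut B (stdJ a b) lieBr Γ)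
    (htrace : ∀ u v, LinearMap.trace ℝ LieAlg (stdJ a b ∘ₗ Γ (lieBr u v)) = 0) :
    0 < b * (b - a) ∧ 0 < a ^ 2 + 1 - a * b := by
  obtain ⟨e, he⟩ := hB.exists_basis_isOrthonormal
  have pos := hΓ.cometric_coord_pos hB he htrace
  obtain ⟨orthogonality, norms⟩ := hB.cometric_coord hb he
  have norm_pos := cometric_self_pos e (coord_ne_zero 0 0)
  have pos₀ := mul_pos (pow_two_pos_of_ne_zero hb) (pos 0)
  have pos₁ := mul_pos (pow_two_pos_of_ne_zero hb) (pos 1)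
  rw [map_add] at pos₀ pos₁
  rw [cometric_comm e (coord 1 0) (coord 0 0)] at pos₁
  constructor
  · refine pos_of_mul_pos_left (b := cometric e (coord 0 0) (coord 0 0)) ?_ norm_pos.le
    linear_combination pos₀ + b * orthogonality
  · refine pos_of_mul_pos_left (b := cometric e (coord 0 0) (coord 0 0)) ?_ norm_pos.le
    linear_combination pos₁ + norms + b * orthogonality

end Inequalities

section Construction

/-- The inner product on the Lie algebra that gives the CYT metrics: the forms `α₁` and `J α₁` are
orthonormal, and `r`, `s` scale the planes of `e_i^-, e_i^+` for `i = 1, 2`. -/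
def cytForm (a b r s : ℝ) : LieAlg →ₗ[ℝ] LieAlg →ₗ[ℝ] ℝ :=
  LinearMap.mk₂ ℝ (fun v w ↦ v 0 0 * w 0 0 + (a * v 0 0 + b * v 1 0) * (a * w 0 0 + b * w 1 0) +
      r * (v 0 1 * w 0 1 + v 0 2 * w 0 2) + s * (v 1 1 * w 1 1 + v 1 2 * w 1 2))
    (by intros; simp; ring) (by intros; simp; ring) (by intros; simp; ring)
    (by intros; simp; ring)

theorem cytForm_apply (a b r s : ℝ) (v w : LieAlg) : cytForm a b r s v w =
    v 0 0 * w 0 0 + (a * v 0 0 + b * v 1 0) * (a * w 0 0 + b * w 1 0) +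
      r * (v 0 1 * w 0 1 + v 0 2 * w 0 2) + s * (v 1 1 * w 1 1 + v 1 2 * w 1 2) := rfl

/-- Opposite rotations in the planes of `e_i^-, e_i^+`: the generator of the holonomy of the
Bismut connections of `cytForm`. -/
def rotation : LieAlg →ₗ[ℝ] LieAlg where
  toFun v := ![![0, -v 0 2, v 0 1], ![0, v 1 2, -v 1 1]]
  map_add' v w := by
    ext i j
    fin_cases i <;> fin_cases j <;> simp <;> ring
  map_smul' c v := by
    ext i j
    fin_cases i <;> fin_cases j <;> simp

theorem rotation_apply (v : LieAlg) :
    rotation v = ![![0, -v 0 2, v 0 1], ![0, v 1 2, -v 1 1]] := rfl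

/-- The area form `e_i^- ∧ e_i^+`. -/
def area (i : Fin 2) (v w : LieAlg) : ℝ := v i 1 * w i 2 - v i 2 * w i 1

theorem area_swap (i : Fin 2) (v w : LieAlg) : area i v w = -area i w v := by
  simp only [area]
  ring

/-- The candidate Bismut connection, with connection form `p α₁ + q α₂`. -/
def cytConnection (p q : ℝ) : LieAlg →ₗ[ℝ] LieAlg →ₗ[ℝ] LieAlg :=
  (p • coord 0 0 + q • coord 1 0).smulRight rotation

theorem cytConnection_apply (p q : ℝ) (u : LieAlg) :
    cytConnection p q u = (p * u 0 0 + q * u 1 0) • rotation := rfl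

theorem trace_stdJ_comp_rotation (a b : ℝ) :
    LinearMap.trace ℝ LieAlg (stdJ a b ∘ₗ rotation) = 0 := by
  simp [trace_lieAlg, Fin.sum_univ_three, rotation_apply, stdJ_apply]

theorem rotation_stdJ (a b : ℝ) (v : LieAlg) :
    rotation (stdJ a b v) = stdJ a b (rotation v) := by
  ext i j
  fin_cases i <;> fin_cases j <;> simp [rotation_apply, stdJ_apply]

variable {a b r s p q : ℝ}

theorem cytForm_comm (v w : LieAlg) : cytForm a b r s v w = cytForm a b r s w v := by
  simp only [cytForm_apply]
  ring

theorem cytForm_self_pos (hb : b ≠ 0) (hr : 0 < r) (hs : 0 < s) {v : LieAlg} (hv : v ≠ 0) :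
    0 < cytForm a b r s v v := by
  contrapose! hv
  rw [cytForm_apply] at hv
  have alpha := mul_self_nonneg (v 0 0)
  have complex := mul_self_nonneg (a * v 0 0 + b * v 1 0)
  have minus₁ := mul_nonneg hr.le (mul_self_nonneg (v 0 1))
  have plus₁ := mul_nonneg hr.le (mul_self_nonneg (v 0 2))
  have minus₂ := mul_nonneg hs.le (mul_self_nonneg (v 1 1))
  have plus₂ := mul_nonneg hs.le (mul_self_nonneg (v 1 2))
  have alpha₁ : v 0 0 = 0 := mul_self_eq_zero.1 (by linarith)
  have alpha₂ : v 1 0 = 0 := by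
    simpa [alpha₁, hb] using mul_self_eq_zero.1 (show (a * v 0 0 + b * v 1 0) *
      (a * v 0 0 + b * v 1 0) = 0 by linarith)
  have scale {t x : ℝ} (ht : 0 < t) (h : t * (x * x) = 0) : x = 0 := by simpa [ht.ne'] using h
  have minus₁_eq := scale (x := v 0 1) hr (by linarith)
  have plus₁_eq := scale (x := v 0 2) hr (by linarith)
  have minus₂_eq := scale (x := v 1 1) hs (by linarith)
  have plus₂_eq := scale (x := v 1 2) hs (by linarith)
  ext i j
  fin_cases i <;> fin_cases j <;> assumption

theorem isHermitianForm_cytForm (hb : b ≠ 0) (hr : 0 < r) (hs : 0 < s) :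
    IsHermitianForm (cytForm a b r s) (stdJ a b) where
  symm := cytForm_comm
  pos _ := cytForm_self_pos hb hr hs
  skew v w := by
    simp [cytForm_apply, stdJ_apply]
    field_simp
    ring

theorem cytForm_rotation (v w : LieAlg) :
    cytForm a b r s (rotation v) w = r * area 0 v w - s * area 1 v w := by
  simp [cytForm_apply, rotation_apply, area]
  ring

theorem cytForm_lieBr (u v w : LieAlg) : cytForm a b r s (lieBr u v) w =
    -(w 0 0 + a * (a * w 0 0 + b * w 1 0)) * area 0 u v - b * (a * w 0 0 + b * w 1 0) * area 1 u v +
      r * (v 0 0 * area 0 u w - u 0 0 * area 0 v w) +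
        s * (v 1 0 * area 1 u w - u 1 0 * area 1 v w) := by
  simp [cytForm_apply, lieBr_apply, cross_apply, area]
  ring

theorem isAlgBismut_cytConnection (rp : r * p = a ^ 2 + 1 - r) (rq : r * q = a * b)
    (sp : s * p = -(a * b)) (sq : s * q = s - b ^ 2) :
    IsAlgBismut (cytForm a b r s) (stdJ a b) lieBr (cytConnection p q) where
  metric u v w := by
    simp only [cytConnection_apply, LinearMap.smul_apply, map_smul, cytForm_rotation,
      smul_eq_mul]
    rw [cytForm_comm v, cytForm_rotation, area_swap 0 w, area_swap 1 w]
    ring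
  complex u v := by
    rw [cytConnection_apply, LinearMap.smul_apply, LinearMap.smul_apply, rotation_stdJ, map_smul]
  skew u v w := by
    simp only [map_sub, LinearMap.sub_apply, cytConnection_apply, LinearMap.smul_apply, map_smul,
      cytForm_rotation, cytForm_lieBr, smul_eq_mul, area_swap _ w v]
    linear_combination
      -(v 0 0 * area 0 u w + w 0 0 * area 0 u v) * rp -
        (v 1 0 * area 0 u w + w 1 0 * area 0 u v) * rq +
          (v 0 0 * area 1 u w + w 0 0 * area 1 u v) * sp +
            (v 1 0 * area 1 u w + w 1 0 * area 1 u v) * sq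

theorem exists_isAlgBismut (h₁ : 0 < b * (b - a)) (h₂ : 0 < a ^ 2 + 1 - a * b) :
    ∃ B Γ, IsHermitianForm B (stdJ a b) ∧ IsAlgBismut B (stdJ a b) lieBr Γ ∧
      ∀ u v, LinearMap.trace ℝ LieAlg (stdJ a b ∘ₗ Γ (lieBr u v)) = 0 := by
  have hb : b ≠ 0 := left_ne_zero_of_mul h₁.ne'
  have hba : b - a ≠ 0 := right_ne_zero_of_mul h₁.ne'
  have hd : a ^ 2 + 1 - b * a ≠ 0 := mul_comm a b ▸ h₂.ne'
  have r_pos : 0 < b / (b - a) := by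
    rw [← mul_div_mul_right b (b - a) hba]
    exact div_pos h₁ (mul_self_pos.2 hba)
  have s_pos : 0 < b ^ 2 / (a ^ 2 + 1 - a * b) := by positivity
  -- The constants solve the four relations of `isAlgBismut_cytConnection`.
  refine ⟨_, cytConnection (-a * (a ^ 2 + 1 - a * b) / b) (a * (b - a)),
    isHermitianForm_cytForm hb r_pos s_pos, isAlgBismut_cytConnection ?_ ?_ ?_ ?_, fun u v ↦ ?_⟩
  · field_simp
    ring
  · field_simp
  · field_simp
  · field_simp
    ring
  · rw [cytConnection_apply, LinearMap.comp_smul, map_smul, trace_stdJ_comp_rotation, smul_zero]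

end Construction
end CYT

end

theorem proposition3 (a b : ℝ) (hb : b ≠ 0) (J : CYT.EndField CYT.I₆ CYT.G)
    (hJ : CYT.IsStructure a b J) :
    (∃ g : CYT.SmoothMetric CYT.I₆ CYT.G, CYT.IsLeftInvariant g ∧ CYT.IsCYT J g) ↔
      0 < b * (b - a) ∧ 0 < a ^ 2 + 1 - a * b := by
  simp only [CYT.isLeftInvariant_iff_isMetricForm]
  rw [CYT.maurerCartanFraming.exists_isCYT_iff hJ.coframeEquiv_apply (CYT.stdJ_stdJ a hb)]
  exact ⟨fun ⟨_, _, hB, hΓ, trace_eq_zero⟩ ↦ hΓ.inequalities hb hB trace_eq_zero,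
    fun ⟨h₁, h₂⟩ ↦ CYT.exists_isAlgBismut h₁ h₂⟩
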